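/- Everything is local at the origin of $\mathbb R^n$, $n\ge 1$, smooth means $C^\infty$ near $0$, and coordinate changes are local diffeomorphisms fixing $0$. **System.** Consider $\dot\xi=F(\xi)+G(\xi)u$ with $F,G$ smooth vector fields, $F(0)=0$, $G(0)\ne0$. A *lower triangular form* is a system $\dot x=f(x)+g(x)v$, $f,g$ smooth, with $f_i=f_i(x_1,\dots,x_{i+1})$ for $i\le n-1$, $g_1=\dots=g_{n-1}=0$, $g_n(0)\neq0$, such that $\partial f_i/\partial x_{i+1}$ ($i\le n-1$) vanishes identically on no nonempty open subset of some neighbourhood of $0$. The given system is *locally feedback equivalent* to it if a feedback $u=a(\xi)+b(\xi)v$ ($a,b$ smooth, $b(0)\ne0$) and a coordinate change $x=T(\xi)$ transform the former into the latter. **Multi-indices.** Tuples in $\mathbb N^k$, $k\le n$, are padded by zeros. $\alpha$ is a *proper $k$-multi-index* if $\alpha_k\ge1$ and $\alpha_j=0$ for $j>k$; it is a multi-index of a smooth function $p$ if $\partial^\alpha p(0)\ne0$. $\alpha$ *generates* $\beta$ if for some coordinate change $y=U(x)$ of the form $y_j=U_j(x_1,\dots,x_j)$ one has $x^\alpha=c\,y^\beta+h(y)$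 with $c\neq0$, $h$ smooth and $\partial^\beta h(0)=0$. $\mathcal E_k(p)$ is the set of proper $k$-multi-indices of $p$ that are not generated by any other multi-index of $p$. A lower triangular form is of *essential type* $[\![\mathcal E_2(f_1),\dots,\mathcal E_n(f_{n-1})]\!]$. **Distributions.** Put $D^{n+1}=0$, $D^n=\hat D^n=\operatorname{span}\{G\}$. For $i=n-1,\dots,1$ take a smooth vector field $G^{i+1}$ that lies in $D^{i+1}$ but not in $D^{i+2}$ (as germs at $0$), put $\hat D^i=\operatorname{span}\{[G^{i+1},F],\hat D^{i+1}\}$, and let $D^i$ be a smooth $(n-i+1)$-dimensional involutive distribution near $0$ with $D^i=\hat D^i$ on an open set whose closure is a neighbourhood of $0$. Let $X^l$ ($1\le l\le n$) be smooth vector fields with $X^l\in D^l$, $X^l(0)\notin D^{l+1}(0)$. For $1\le i\le n-1$ a tuple $Y^i=(Y^{i,1},\dots,Y^{i,i+1})$ of smooth vector fields is *adapted* (to $D$ and $X$) if, for $1\le j\le i+1$, $Y^{i,j}\in D^j$, $Y^{i,j}(0)\notin D^{j+1}(0)$, $[X^l,Y^{i,j}]\in D^{i+1}$ for $i+1\le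 l\le n$, and $[X^i,Y^{i,j}]\in D^i$. Write $\mathrm{ad}_YZ=[Y,Z]$ and $\mathrm{ad}_{Y^i}^\alpha F=\mathrm{ad}_{Y^{i,1}}^{\alpha_1}\cdots\mathrm{ad}_{Y^{i,i+1}}^{\alpha_{i+1}}F$. **Theorem.** Let $[\![\mathcal E_2(f_1),\dots,\mathcal E_n(f_{n-1})]\!]$ be the essential type of some lower triangular form. The system $\dot\xi=F+Gu$ is locally feedback equivalent to a lower triangular form of this type if and only if (i) it is locally feedback equivalent to some lower triangular form; and (ii) for all $D^l$ and $X^l$ as above, every $i=1,\dots,n-1$ and every adapted tuple $Y^i$: $\mathrm{ad}_{Y^i}^{\epsilon}F(0)\notin D^{i+1}(0)$ for every $\epsilon\in\mathcal E_{i+1}(f_i)$, and $\mathrm{ad}_{Y^i}^{\zeta}F(0)\in D^{i+1}(0)$ for every proper $(i+1)$-multi-index $\zeta$ that is generated by no element of $\mathcal E_{i+1}(f_i)$. The equivalence also holds with (ii) required only for one choice: there exist $D^l$, $X^l$ as above and, for every $i$, an adapted tuple $Y^i$ with these properties. -/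

import Mathlib

open Filter Topology
open scoped ContDiff

namespace TriForm

/-! Everything is local at the origin of `ℝⁿ = (Fin n → ℝ)`: functions, vector fields and
distributions are total functions of which only the germ at `0` is used. Coordinates are numbered
from `0`, so the `k`-th coordinate of the text (`1 ≤ k ≤ n`) is the index `k - 1`. -/

/-- Smooth (of class `C^∞`) on some neighbourhood of the origin. -/
def SmoothNear {n : ℕ} {E : Type*} [NormedAddCommGroup E] [NormedSpace ℝ E]
    (p : (Fin n → ℝ) → E) : Prop :=
  ∀ᶠ x in 𝓝 (0 : Fin n → ℝ), ContDiffAt ℝ ∞ p x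

/-- Near the origin, `p` is a function of the first `k` coordinates only. -/
def DependsOnFirst {n : ℕ} (k : ℕ) (p : (Fin n → ℝ) → ℝ) : Prop :=
  ∃ U ∈ 𝓝 (0 : Fin n → ℝ), ∀ x ∈ U, ∀ y ∈ U, (∀ j : Fin n, (j : ℕ) < k → x j = y j) → p x = p y

/-- A (smooth, local, origin preserving) change of coordinates. -/
structure IsCoordChange {n : ℕ} (T : OpenPartialHomeomorph (Fin n → ℝ) (Fin n → ℝ)) : Prop where
  zero_mem : (0 : Fin n → ℝ) ∈ T.source
  map_zero : T 0 = 0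
  smooth : ContDiffOn ℝ ∞ T T.source
  smooth_symm : ContDiffOn ℝ ∞ T.symm T.target

/-- A lower triangular change of coordinates: `y_j = U_j(x_1, …, x_j)` for every `j`. -/
structure IsLowerTriangularChange {n : ℕ}
    (U : OpenPartialHomeomorph (Fin n → ℝ) (Fin n → ℝ)) : Prop extends IsCoordChange U where
  triangular : ∀ j : Fin n, DependsOnFirst ((j : ℕ) + 1) (fun x => U x j)

/-! ### Multi-indices

A multi-index is a function `Fin n → ℕ`; shorter tuples are padded by zeros, in accordance with the
convention that trailing zeros are irrelevant for equality of multi-indices. -/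

/-- `α` is a proper `k`-multi-index (`k` counted from `1`): `α_k ≥ 1` and all later entries vanish;
for `k = 0` it says `α = 0`. -/
def IsProper {n : ℕ} (k : ℕ) (α : Fin n → ℕ) : Prop :=
  (∀ j : Fin n, k ≤ (j : ℕ) → α j = 0) ∧ (k ≠ 0 → ∃ j : Fin n, (j : ℕ) + 1 = k ∧ 1 ≤ α j)

/-- The monomial `x^α`. -/
def monomial {n : ℕ} (α : Fin n → ℕ) (x : Fin n → ℝ) : ℝ := ∏ j, x j ^ α j

/-- `∂p/∂x_j`. -/
noncomputable def partialDeriv {n : ℕ} (j : Fin n) (p : (Fin n → ℝ) → ℝ) : (Fin n → ℝ) → ℝ :=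
  fun x => fderiv ℝ p x (Pi.single j 1)

/-- `∂^α p / ∂x^α = ∂_1^{α_1} ⋯ ∂_n^{α_n} p`. -/
noncomputable def multiDeriv {n : ℕ} (α : Fin n → ℕ) (p : (Fin n → ℝ) → ℝ) : (Fin n → ℝ) → ℝ :=
  (List.finRange n).foldr (fun j q => (partialDeriv j)^[α j] q) p

/-- The set of multi-indices of the function `p`. -/
def indices {n : ℕ} (p : (Fin n → ℝ) → ℝ) : Set (Fin n → ℕ) :=
  {α | multiDeriv α p 0 ≠ 0}

/-- `α` generates `β`: for some lower triangular change of coordinates `y = U(x)` one has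
`x^α = c y^β + h(y)` with `c ≠ 0` and `∂^β h / ∂y^β (0) = 0`. -/
def Generates {n : ℕ} (α β : Fin n → ℕ) : Prop :=
  ∃ U : OpenPartialHomeomorph (Fin n → ℝ) (Fin n → ℝ), IsLowerTriangularChange U ∧
    ∃ (c : ℝ) (h : (Fin n → ℝ) → ℝ), c ≠ 0 ∧ SmoothNear h ∧ multiDeriv β h 0 = 0 ∧
      ∀ᶠ y in 𝓝 (0 : Fin n → ℝ), monomial α (U.symm y) = c * monomial β y + h y

/-- The greatest essential `k`-multi-index set of `p`: the proper `k`-multi-indices of `p` which are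
not generated by any other multi-index of `p`. -/
def essentialSet {n : ℕ} (k : ℕ) (p : (Fin n → ℝ) → ℝ) : Set (Fin n → ℕ) :=
  {α | IsProper k α ∧ α ∈ indices p ∧ ∀ α' ∈ indices p, ¬ (Generates α' α ∧ α' ≠ α)}

/-! ### Lower triangular forms and feedback equivalence

The dimension is `n = m + 1`. The index `i : Fin m` stands for the number `i + 1 ∈ {1, …, n - 1}` of
the text. -/

/-- `ẋ = f(x) + g(x) v` is a lower triangular form. -/
structure IsLowerTriangularForm {m : ℕ} (f g : (Fin (m + 1) → ℝ) → (Fin (m + 1) → ℝ)) : Prop where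
  smooth_drift : SmoothNear f
  smooth_input : SmoothNear g
  input_eq_zero : ∀ i : Fin m, ∀ᶠ x in 𝓝 (0 : Fin (m + 1) → ℝ), g x i.castSucc = 0
  input_last_ne_zero : g 0 (Fin.last m) ≠ 0
  triangular : ∀ i : Fin m, DependsOnFirst ((i : ℕ) + 2) (fun x => f x i.castSucc)
  /-- `∂f_i/∂x_{i+1}` vanishes identically on no nonempty open subset of a neighbourhood of `0`. -/
  nondegenerate : ∀ i : Fin m, ∃ U ∈ 𝓝 (0 : Fin (m + 1) → ℝ),
    ∀ V : Set (Fin (m + 1) → ℝ), IsOpen V → V.Nonempty → V ⊆ U →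
      ∃ x ∈ V, partialDeriv i.succ (fun y => f y i.castSucc) x ≠ 0

/-- The essential type `⟦E_2(f_1), …, E_n(f_{n-1})⟧`. -/
def essentialType {m : ℕ} (f : (Fin (m + 1) → ℝ) → (Fin (m + 1) → ℝ)) :
    Fin m → Set (Fin (m + 1) → ℕ) :=
  fun i => essentialSet ((i : ℕ) + 2) (fun x => f x i.castSucc)

/-- The system `ξ̇ = F(ξ) + G(ξ) u` is locally transformed into `ẋ = f(x) + g(x) v` by a feedback
`u = a(ξ) + b(ξ) v`, `b(0) ≠ 0`, and a change of coordinates `x = T(ξ)`. -/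
def FeedbackEquivalent {n : ℕ} (F G f g : (Fin n → ℝ) → (Fin n → ℝ)) : Prop :=
  ∃ (a b : (Fin n → ℝ) → ℝ) (T : OpenPartialHomeomorph (Fin n → ℝ) (Fin n → ℝ)),
    SmoothNear a ∧ SmoothNear b ∧ b 0 ≠ 0 ∧ IsCoordChange T ∧
    ∀ᶠ ξ in 𝓝 (0 : Fin n → ℝ),
      fderiv ℝ T ξ (F ξ + a ξ • G ξ) = f (T ξ) ∧ fderiv ℝ T ξ (b ξ • G ξ) = g (T ξ)

/-! ### Distributions and Lie brackets -/

/-- The vector field `V` lies in the distribution `D` near the origin. -/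
def SectionOf {n : ℕ} (D : (Fin n → ℝ) → Submodule ℝ (Fin n → ℝ))
    (V : (Fin n → ℝ) → (Fin n → ℝ)) : Prop :=
  ∀ᶠ x in 𝓝 (0 : Fin n → ℝ), V x ∈ D x

/-- Near the origin, `D` is a smooth `d`-dimensional involutive distribution. -/
structure IsInvolutiveDistribution {n : ℕ} (d : ℕ)
    (D : (Fin n → ℝ) → Submodule ℝ (Fin n → ℝ)) : Prop where
  frame : ∃ V : Fin d → (Fin n → ℝ) → (Fin n → ℝ), (∀ k, SmoothNear (V k)) ∧
    ∀ᶠ x in 𝓝 (0 : Fin n → ℝ), LinearIndependent ℝ (fun k => V k x) ∧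
      D x = Submodule.span ℝ (Set.range fun k => V k x)
  involutive : ∀ V W : (Fin n → ℝ) → (Fin n → ℝ), SmoothNear V → SmoothNear W →
    SectionOf D V → SectionOf D W → SectionOf D (VectorField.lieBracket ℝ V W)

/-- The distributions `D^1 ⊇ ⋯ ⊇ D^{n+1} = 0` of a system `ξ̇ = F + G u` in dimension `n = m + 1`;
`D l` is `D^{l+1}` of the text, and only `D 0, …, D (m + 1)` matter. Starting from
`D^n = \hat D^n = span {G}`, one takes vector fields `G^{i+1}` in `D^{i+1}` but not in `D^{i+2}`, sets
`\hat D^i = span {ad_{G^{i+1}} F, \hat D^{i+1}}`, and `D^i` is an `(n - i + 1)`-dimensional involutive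
distribution which agrees with `\hat D^i` on an open set whose closure is a neighbourhood of `0`. -/
def IsTriangularFlag {m : ℕ} (F G : (Fin (m + 1) → ℝ) → (Fin (m + 1) → ℝ))
    (D : ℕ → (Fin (m + 1) → ℝ) → Submodule ℝ (Fin (m + 1) → ℝ)) : Prop :=
  (∀ᶠ x in 𝓝 (0 : Fin (m + 1) → ℝ), D (m + 1) x = ⊥) ∧
  (∀ᶠ x in 𝓝 (0 : Fin (m + 1) → ℝ), D m x = Submodule.span ℝ {G x}) ∧
  (∀ l ≤ m + 1, IsInvolutiveDistribution (m + 1 - l) (D l)) ∧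
  ∃ (H : ℕ → (Fin (m + 1) → ℝ) → (Fin (m + 1) → ℝ))
    (Dhat : ℕ → (Fin (m + 1) → ℝ) → Submodule ℝ (Fin (m + 1) → ℝ)),
    (∀ x, Dhat m x = Submodule.span ℝ {G x}) ∧
    ∀ i < m,
      SmoothNear (H (i + 1)) ∧ SectionOf (D (i + 1)) (H (i + 1)) ∧
      ¬ SectionOf (D (i + 2)) (H (i + 1)) ∧
      (∀ x, Dhat i x =
        Submodule.span ℝ {VectorField.lieBracket ℝ (H (i + 1)) F x} ⊔ Dhat (i + 1) x) ∧
      ∃ O : Set (Fin (m + 1) → ℝ), IsOpen O ∧ closure O ∈ 𝓝 (0 : Fin (m + 1) → ℝ) ∧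
        ∀ x ∈ O, D i x = Dhat i x

/-- Smooth vector fields `X^l ∈ D^l` with `X^l(0) ∉ D^{l+1}(0)`, `l = 1, …, n`. -/
def IsAdaptedFrame {m : ℕ} (D : ℕ → (Fin (m + 1) → ℝ) → Submodule ℝ (Fin (m + 1) → ℝ))
    (X : Fin (m + 1) → (Fin (m + 1) → ℝ) → (Fin (m + 1) → ℝ)) : Prop :=
  ∀ l : Fin (m + 1), SmoothNear (X l) ∧ SectionOf (D l) (X l) ∧ X l 0 ∉ D ((l : ℕ) + 1) 0

/-- `Y = (Y^{i,1}, …, Y^{i,i+1})` is a tuple adapted to `D` and `X`; entries of `Y` beyond these are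
irrelevant. The brackets `[X^l, Y^{i,j}]` lie in `D^{i+1}` for `l ≥ i + 1` and in `D^i` for `l = i`. -/
def IsAdaptedTuple {m : ℕ} (D : ℕ → (Fin (m + 1) → ℝ) → Submodule ℝ (Fin (m + 1) → ℝ))
    (X : Fin (m + 1) → (Fin (m + 1) → ℝ) → (Fin (m + 1) → ℝ)) (i : Fin m)
    (Y : Fin (m + 1) → (Fin (m + 1) → ℝ) → (Fin (m + 1) → ℝ)) : Prop :=
  ∀ j : Fin (m + 1), j ≤ i.succ →
    SmoothNear (Y j) ∧ SectionOf (D j) (Y j) ∧ Y j 0 ∉ D ((j : ℕ) + 1) 0 ∧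
    (∀ l : Fin (m + 1), i.succ ≤ l →
      SectionOf (D ((i : ℕ) + 1)) (VectorField.lieBracket ℝ (X l) (Y j))) ∧
    SectionOf (D (i : ℕ)) (VectorField.lieBracket ℝ (X i.castSucc) (Y j))

/-- `ad_Y^α Z = ad_{Y^1}^{α_1} ⋯ ad_{Y^n}^{α_n} Z`, where `ad_X Z = [X, Z]`. -/
noncomputable def adMulti {n : ℕ} (Y : Fin n → (Fin n → ℝ) → (Fin n → ℝ)) (α : Fin n → ℕ)
    (Z : (Fin n → ℝ) → (Fin n → ℝ)) : (Fin n → ℝ) → (Fin n → ℝ) :=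
  (List.finRange n).foldr (fun j W => (VectorField.lieBracket ℝ (Y j))^[α j] W) Z

/-- The Lie bracket test for the `i`-th set `S` of an essential type: `ad_Y^ε F(0) ∉ D^{i+1}(0)` for
all `ε ∈ S`, and `ad_Y^ζ F(0) ∈ D^{i+1}(0)` for all proper `(i+1)`-multi-indices `ζ` that are generated
by no element of `S`. -/
def BracketTest {m : ℕ} (F : (Fin (m + 1) → ℝ) → (Fin (m + 1) → ℝ))
    (D : ℕ → (Fin (m + 1) → ℝ) → Submodule ℝ (Fin (m + 1) → ℝ)) (i : Fin m)
    (Y : Fin (m + 1) → (Fin (m + 1) → ℝ) → (Fin (m + 1) → ℝ))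
    (S : Set (Fin (m + 1) → ℕ)) : Prop :=
  (∀ ε ∈ S, adMulti Y ε F 0 ∉ D ((i : ℕ) + 1) 0) ∧
  ∀ ζ : Fin (m + 1) → ℕ, IsProper ((i : ℕ) + 2) ζ → (¬ ∃ ε ∈ S, Generates ε ζ) →
    adMulti Y ζ F 0 ∈ D ((i : ℕ) + 1) 0

end TriForm

namespace TriForm

/-! ### Calculus of germs at the origin -/

section Germs

variable {n : ℕ}

/-! Generation is a partial order in disguise. For a proper `k`-multi-index `α`, and `β` supported
on the first `k` entries, `α` generates `β` if and only if every initial sum `α_1 + ⋯ + α_J` is at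
most that of `β` (`SumLE`). For necessity (`Generates.sumLE`), a triangular change preserves the
ideal of germs in the first `J` coordinates vanishing at `0`. Thus `x^α` lies in the power of this
ideal with exponent the `J`-th sum of `α`, and `∂^β` lowers that exponent by at most the `J`-th sum
of `β`. For sufficiency (`generates_of_sumLE`), one change serves all pairs: under `x_j = exp (y_1 +
⋯ + y_j) - 1` all derivatives of monomials at `0` are nonnegative, and the required ones are
positive. Essential multi-indices are therefore the minimal proper multi-indices of `f_i`.

The brackets compute derivatives up to lower terms in this order. In a chart `T` where the system is
triangular, every admissible `D^l` is spanned near `0` by the last coordinate fields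
(`IsTriangularChart.eq_annih`), so membership in `D^{i+1}(0)` means vanishing of the first `i`
components. Adaptedness says that the first `i - 1` components of each `Y^{i,j}` are constant along
`D^i`, and that the derivative of the `i`-th along a field `W` in `D^i` is a multiple of the `i`-th
component of `W` (`IsTriangularChart.isChartTuple`). By induction on the number of brackets, the
components of `ad_Y^α F` before the `i`-th vanish, and the `i`-th is `a · (∂^α f_i ∘ T)` with `a(0)
≠ 0`, plus a smooth combination of `∂^β f_i ∘ T` with `β` strictly below `α` and `β_{i+1} ≠ 0`
(`IsTriangularChart.hasLeadingTerm_adMulti`). If all those lower derivatives vanish at `0`, the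
bracket at `0` lies in `D^{i+1}(0)` exactly when `∂^α f_i(0) = 0`.

Hence any triangular form of the system passes the test for its own type, and since two sets of
minimal elements that dominate each other coincide, passing the test for a given type forces that
type. The coordinate fields of a triangular chart provide admissible data, which connects the
version for all choices with the version for one choice. -/

theorem SmoothNear.congr {E : Type*} [NormedAddCommGroup E] [NormedSpace ℝ E]
    {p q : (Fin n → ℝ) → E} (hp : SmoothNear p) (h : q =ᶠ[𝓝 0] p) : SmoothNear q := by
  filter_upwards [hp, h.eventually_nhds] with x hx hqx using hx.congr_of_eventuallyEq hqx

theorem ContDiff.smoothNear {E : Type*} [NormedAddCommGroup E] [NormedSpace ℝ E]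
    {p : (Fin n → ℝ) → E} (hp : ContDiff ℝ ∞ p) : SmoothNear p :=
  Eventually.of_forall fun _ => hp.contDiffAt

theorem smoothNear_const {E : Type*} [NormedAddCommGroup E] [NormedSpace ℝ E] (c : E) :
    SmoothNear (fun _ : Fin n → ℝ => c) :=
  Eventually.of_forall fun _ => contDiffAt_const

theorem SmoothNear.add {E : Type*} [NormedAddCommGroup E] [NormedSpace ℝ E]
    {p q : (Fin n → ℝ) → E} (hp : SmoothNear p) (hq : SmoothNear q) :
    SmoothNear (fun x => p x + q x) := by
  filter_upwards [hp, hq] with x h1 h2 using h1.add h2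

theorem SmoothNear.sub {E : Type*} [NormedAddCommGroup E] [NormedSpace ℝ E]
    {p q : (Fin n → ℝ) → E} (hp : SmoothNear p) (hq : SmoothNear q) :
    SmoothNear (fun x => p x - q x) := by
  filter_upwards [hp, hq] with x h1 h2 using h1.sub h2

theorem SmoothNear.mul {p q : (Fin n → ℝ) → ℝ} (hp : SmoothNear p) (hq : SmoothNear q) :
    SmoothNear (fun x => p x * q x) := by
  filter_upwards [hp, hq] with x h1 h2 using h1.mul h2

theorem SmoothNear.const_mul {p : (Fin n → ℝ) → ℝ} (c : ℝ) (hp : SmoothNear p) :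
    SmoothNear (fun x => c * p x) :=
  (smoothNear_const c).mul hp

theorem SmoothNear.pow {p : (Fin n → ℝ) → ℝ} (hp : SmoothNear p) (k : ℕ) :
    SmoothNear (fun x => p x ^ k) := by
  filter_upwards [hp] with x h1 using h1.pow k

theorem SmoothNear.div {p q : (Fin n → ℝ) → ℝ} (hp : SmoothNear p) (hq : SmoothNear q)
    (h0 : q 0 ≠ 0) : SmoothNear (fun x => p x / q x) := by
  filter_upwards [hp, hq, hq.self_of_nhds.continuousAt.eventually_ne h0] with x h1 h2 h3
    using h1.div h2 h3

theorem SmoothNear.sum {ι : Type*} (s : Finset ι) {p : ι → (Fin n → ℝ) → ℝ}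
    (hp : ∀ k ∈ s, SmoothNear (p k)) : SmoothNear (fun x => ∑ k ∈ s, p k x) := by
  have h : ∀ᶠ x in 𝓝 (0 : Fin n → ℝ), ∀ k ∈ s, ContDiffAt ℝ ∞ (p k) x :=
    (Filter.eventually_all_finset s).2 hp
  filter_upwards [h] with x hx using ContDiffAt.sum hx

theorem SmoothNear.prod {ι : Type*} (s : Finset ι) {p : ι → (Fin n → ℝ) → ℝ}
    (hp : ∀ k ∈ s, SmoothNear (p k)) : SmoothNear (fun x => ∏ k ∈ s, p k x) := by
  have h : ∀ᶠ x in 𝓝 (0 : Fin n → ℝ), ∀ k ∈ s, ContDiffAt ℝ ∞ (p k) x :=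
    (Filter.eventually_all_finset s).2 hp
  filter_upwards [h] with x hx using contDiffAt_prod hx

theorem SmoothNear.apply {k : ℕ} {V : (Fin n → ℝ) → Fin k → ℝ} (hV : SmoothNear V) (c : Fin k) :
    SmoothNear (fun x => V x c) := by
  filter_upwards [hV] with x hx using contDiffAt_pi.1 hx c

theorem SmoothNear.comp {k : ℕ} {E : Type*} [NormedAddCommGroup E] [NormedSpace ℝ E]
    {q : (Fin k → ℝ) → E} {T : (Fin n → ℝ) → Fin k → ℝ} (hq : SmoothNear q) (hT : SmoothNear T)
    (h0 : T 0 = 0) : SmoothNear (fun x => q (T x)) := by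
  have hc : Tendsto T (𝓝 0) (𝓝 0) := by
    simpa [h0] using hT.self_of_nhds.continuousAt.tendsto
  filter_upwards [hc.eventually hq, hT] with x h1 h2 using ContDiffAt.fun_comp x h1 h2

theorem SmoothNear.differentiableAt {E : Type*} [NormedAddCommGroup E] [NormedSpace ℝ E]
    {p : (Fin n → ℝ) → E} (hp : SmoothNear p) : ∀ᶠ x in 𝓝 0, DifferentiableAt ℝ p x := by
  filter_upwards [hp] with x h using h.differentiableAt (by simp)

theorem SmoothNear.fderiv_apply {E : Type*} [NormedAddCommGroup E] [NormedSpace ℝ E]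
    {p : (Fin n → ℝ) → E} {V : (Fin n → ℝ) → Fin n → ℝ} (hp : SmoothNear p) (hV : SmoothNear V) :
    SmoothNear (fun x => fderiv ℝ p x (V x)) := by
  filter_upwards [hp, hV] with x h1 h2
    using (h1.fderiv_right (m := ∞) (by simp)).clm_apply h2

theorem SmoothNear.lieBracket {V W : (Fin n → ℝ) → Fin n → ℝ} (hV : SmoothNear V)
    (hW : SmoothNear W) : SmoothNear (VectorField.lieBracket ℝ V W) :=
  (hW.fderiv_apply hV).sub (hV.fderiv_apply hW)

/-- The derivative of the function `p` along the vector field `V`. -/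
noncomputable def der (V : (Fin n → ℝ) → Fin n → ℝ) (p : (Fin n → ℝ) → ℝ) : (Fin n → ℝ) → ℝ :=
  fun x => fderiv ℝ p x (V x)

theorem SmoothNear.der {V : (Fin n → ℝ) → Fin n → ℝ} {p : (Fin n → ℝ) → ℝ} (hV : SmoothNear V)
    (hp : SmoothNear p) : SmoothNear (der V p) :=
  hp.fderiv_apply hV

theorem der_congr {V : (Fin n → ℝ) → Fin n → ℝ} {p q : (Fin n → ℝ) → ℝ} (h : p =ᶠ[𝓝 0] q) :
    der V p =ᶠ[𝓝 0] der V q := by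
  filter_upwards [h.fderiv (𝕜 := ℝ)] with x hx
  simp only [der, hx]

theorem der_const (V : (Fin n → ℝ) → Fin n → ℝ) (c : ℝ) : der V (fun _ => c) = fun _ => 0 := by
  funext x
  simp [der]

theorem der_eq_zero_of_eventuallyEq_const {V : (Fin n → ℝ) → Fin n → ℝ} {p : (Fin n → ℝ) → ℝ}
    {c : ℝ} (h : ∀ᶠ x in 𝓝 0, p x = c) : ∀ᶠ x in 𝓝 0, der V p x = 0 := by
  have := der_congr (V := V) (q := fun _ => c) h
  rwa [der_const] at this

theorem der_add {V : (Fin n → ℝ) → Fin n → ℝ} {p q : (Fin n → ℝ) → ℝ} (hp : SmoothNear p)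
    (hq : SmoothNear q) : der V (fun x => p x + q x) =ᶠ[𝓝 0] fun x => der V p x + der V q x := by
  filter_upwards [hp.differentiableAt, hq.differentiableAt] with x h1 h2
  simp [der, fderiv_fun_add h1 h2]

theorem der_mul {V : (Fin n → ℝ) → Fin n → ℝ} {p q : (Fin n → ℝ) → ℝ} (hp : SmoothNear p)
    (hq : SmoothNear q) :
    der V (fun x => p x * q x) =ᶠ[𝓝 0] fun x => p x * der V q x + der V p x * q x := by
  filter_upwards [hp.differentiableAt, hq.differentiableAt] with x h1 h2
  simp [der, fderiv_fun_mul h1 h2, mul_comm]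

theorem der_const_mul {V : (Fin n → ℝ) → Fin n → ℝ} {p : (Fin n → ℝ) → ℝ} (c : ℝ)
    (hp : SmoothNear p) : der V (fun x => c * p x) =ᶠ[𝓝 0] fun x => c * der V p x := by
  filter_upwards [der_mul (V := V) (smoothNear_const c) hp] with x hx
  rw [hx, der_const]
  simp

theorem der_lieBracket {V W : (Fin n → ℝ) → Fin n → ℝ} {p : (Fin n → ℝ) → ℝ} (hV : SmoothNear V)
    (hW : SmoothNear W) (hp : SmoothNear p) :
    der (VectorField.lieBracket ℝ V W) p =ᶠ[𝓝 0] fun x => der V (der W p) x - der W (der V p) x := by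
  filter_upwards [hp, hV.differentiableAt, hW.differentiableAt] with x h1 h2 h3
  exact VectorField.fderiv_apply_lieBracket h1
    (by rw [minSmoothness_of_isRCLikeNormedField]; exact WithTop.coe_le_coe.2 le_top) h3 h2

theorem fderiv_apply_eq_sum_partialDeriv (q : (Fin n → ℝ) → ℝ) (x v : Fin n → ℝ) :
    fderiv ℝ q x v = ∑ k, v k * partialDeriv k q x := by
  conv_lhs => rw [← Finset.univ_sum_single v, map_sum]
  refine Finset.sum_congr rfl fun k _ => ?_
  rw [partialDeriv, ← smul_eq_mul, ← map_smul, ← Pi.single_smul, smul_eq_mul, mul_one]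

theorem fderiv_coord_apply {k : ℕ} {T : (Fin n → ℝ) → Fin k → ℝ} {x : Fin n → ℝ}
    (hT : DifferentiableAt ℝ T x) (v : Fin n → ℝ) (c : Fin k) :
    fderiv ℝ (fun x => T x c) x v = fderiv ℝ T x v c := by
  rw [((hasFDerivAt_pi'.1 hT.hasFDerivAt) c).fderiv]
  rfl

theorem der_comp {V T : (Fin n → ℝ) → Fin n → ℝ} {q : (Fin n → ℝ) → ℝ} (hT : SmoothNear T)
    (h0 : T 0 = 0) (hq : SmoothNear q) :
    der V (fun x => q (T x)) =ᶠ[𝓝 0]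
      fun x => ∑ k, der V (fun x => T x k) x * partialDeriv k q (T x) := by
  have hc : Tendsto T (𝓝 0) (𝓝 0) := by
    simpa [h0] using hT.self_of_nhds.continuousAt.tendsto
  filter_upwards [hT.differentiableAt, hc.eventually hq.differentiableAt] with x h1 h2
  simp only [der]
  have h3 : fderiv ℝ (fun x => q (T x)) x = (fderiv ℝ q (T x)).comp (fderiv ℝ T x) :=
    fderiv_comp x h2 h1
  rw [h3, ContinuousLinearMap.comp_apply, fderiv_apply_eq_sum_partialDeriv]
  refine Finset.sum_congr rfl fun k _ => ?_
  rw [fderiv_coord_apply h1]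

/-! ### Partial derivatives -/

theorem partialDeriv_eq_der (j : Fin n) (p : (Fin n → ℝ) → ℝ) :
    partialDeriv j p = der (fun _ => Pi.single j 1) p := rfl

theorem SmoothNear.partialDeriv {p : (Fin n → ℝ) → ℝ} (hp : SmoothNear p) (j : Fin n) :
    SmoothNear (partialDeriv j p) :=
  (smoothNear_const _).der hp

/-- Constant vector fields have zero Lie bracket, so the commutator formula gives symmetry of second
derivatives. -/
theorem partialDeriv_comm {p : (Fin n → ℝ) → ℝ} (hp : SmoothNear p) (j k : Fin n) :
    partialDeriv j (partialDeriv k p) =ᶠ[𝓝 0] partialDeriv k (partialDeriv j p) := by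
  filter_upwards [der_lieBracket (smoothNear_const (Pi.single j 1)) (smoothNear_const (Pi.single k 1))
    hp] with x hx
  simp only [partialDeriv_eq_der]
  have : der (VectorField.lieBracket ℝ (fun _ : Fin n → ℝ => Pi.single j (1 : ℝ))
      (fun _ => Pi.single k 1)) p x = 0 := by
    simp [der, VectorField.lieBracket]
  linarith

theorem partialDeriv_iterate_congr (j : Fin n) {p q : (Fin n → ℝ) → ℝ} (h : p =ᶠ[𝓝 0] q) (r : ℕ) :
    (partialDeriv j)^[r] p =ᶠ[𝓝 0] (partialDeriv j)^[r] q := by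
  induction r generalizing p q with
  | zero => exact h
  | succ r ih => exact ih (der_congr h)

theorem SmoothNear.partialDeriv_iterate {p : (Fin n → ℝ) → ℝ} (hp : SmoothNear p) (j : Fin n)
    (r : ℕ) : SmoothNear ((TriForm.partialDeriv j)^[r] p) := by
  induction r generalizing p with
  | zero => exact hp
  | succ r ih => exact ih (hp.partialDeriv j)

theorem partialDeriv_iterate_comm {p : (Fin n → ℝ) → ℝ} (hp : SmoothNear p) (j k : Fin n) (r : ℕ) :
    (partialDeriv j)^[r] (partialDeriv k p) =ᶠ[𝓝 0] partialDeriv k ((partialDeriv j)^[r] p) := by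
  induction r generalizing p with
  | zero => rfl
  | succ r ih =>
    exact (partialDeriv_iterate_congr j (partialDeriv_comm hp j k) r).trans (ih (hp.partialDeriv j))

/-- The part of `multiDeriv` which belongs to the coordinates in the list `l`. -/
noncomputable def listDeriv (α : Fin n → ℕ) (l : List (Fin n)) (p : (Fin n → ℝ) → ℝ) :
    (Fin n → ℝ) → ℝ :=
  l.foldr (fun j q => (partialDeriv j)^[α j] q) p

theorem multiDeriv_eq_listDeriv (α : Fin n → ℕ) (p : (Fin n → ℝ) → ℝ) :
    multiDeriv α p = listDeriv α (List.finRange n) p := rfl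

theorem SmoothNear.listDeriv {p : (Fin n → ℝ) → ℝ} (hp : SmoothNear p) (α : Fin n → ℕ)
    (l : List (Fin n)) : SmoothNear (listDeriv α l p) := by
  induction l with
  | nil => exact hp
  | cons j l ih => exact ih.partialDeriv_iterate j (α j)

theorem listDeriv_congr (α : Fin n → ℕ) (l : List (Fin n)) {p q : (Fin n → ℝ) → ℝ}
    (h : p =ᶠ[𝓝 0] q) : listDeriv α l p =ᶠ[𝓝 0] listDeriv α l q := by
  induction l with
  | nil => exact h
  | cons j l ih => exact partialDeriv_iterate_congr j ih (α j)

theorem listDeriv_partialDeriv (α : Fin n → ℕ) (l : List (Fin n)) {p : (Fin n → ℝ) → ℝ}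
    (hp : SmoothNear p) (k : Fin n) :
    listDeriv α l (partialDeriv k p) =ᶠ[𝓝 0] partialDeriv k (listDeriv α l p) := by
  induction l with
  | nil => rfl
  | cons j l ih =>
    exact (partialDeriv_iterate_congr j ih (α j)).trans
      (partialDeriv_iterate_comm (hp.listDeriv α l) j k (α j))

theorem listDeriv_add_single_of_notMem (α : Fin n → ℕ) (l : List (Fin n)) (k : Fin n) (hk : k ∉ l)
    (p : (Fin n → ℝ) → ℝ) : listDeriv (α + Pi.single k 1) l p = listDeriv α l p := by
  induction l with
  | nil => rfl
  | cons j l ih =>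
    have hjk : j ≠ k := by rintro rfl; exact hk (by simp)
    have hl : k ∉ l := fun h => hk (by simp [h])
    have e : (α + Pi.single k 1 : Fin n → ℕ) j = α j := by simp [Pi.single_eq_of_ne hjk]
    change (partialDeriv j)^[(α + Pi.single k 1 : Fin n → ℕ) j] _ = (partialDeriv j)^[α j] _
    rw [e]
    exact congrArg _ (ih hl)

/-- Without repetitions in `l` the extra unit acts exactly once; commuting derivatives bring it to
the front. -/
theorem listDeriv_add_single_of_mem (α : Fin n → ℕ) (l : List (Fin n)) (hl : l.Nodup) (k : Fin n)
    (hk : k ∈ l) {p : (Fin n → ℝ) → ℝ} (hp : SmoothNear p) :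
    listDeriv (α + Pi.single k 1) l p =ᶠ[𝓝 0] partialDeriv k (listDeriv α l p) := by
  induction l with
  | nil => simp at hk
  | cons j l ih =>
    rw [List.nodup_cons] at hl
    change (partialDeriv j)^[(α + Pi.single k 1 : Fin n → ℕ) j] (listDeriv _ l p) =ᶠ[𝓝 0]
      partialDeriv k ((partialDeriv j)^[α j] (listDeriv α l p))
    rcases eq_or_ne j k with rfl | hjk
    · have e : (α + Pi.single j 1 : Fin n → ℕ) j = α j + 1 := by simp
      rw [e, listDeriv_add_single_of_notMem α l j hl.1, Function.iterate_succ_apply']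
    · have e : (α + Pi.single k 1 : Fin n → ℕ) j = α j := by simp [Pi.single_eq_of_ne hjk]
      have hk' : k ∈ l := by simpa [hjk.symm] using hk
      rw [e]
      exact (partialDeriv_iterate_congr j (ih hl.2 hk') (α j)).trans
        (partialDeriv_iterate_comm (hp.listDeriv α l) j k (α j))

theorem SmoothNear.multiDeriv {p : (Fin n → ℝ) → ℝ} (hp : SmoothNear p) (α : Fin n → ℕ) :
    SmoothNear (multiDeriv α p) :=
  hp.listDeriv α _

theorem multiDeriv_congr (α : Fin n → ℕ) {p q : (Fin n → ℝ) → ℝ} (h : p =ᶠ[𝓝 0] q) :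
    multiDeriv α p =ᶠ[𝓝 0] multiDeriv α q :=
  listDeriv_congr α _ h

theorem multiDeriv_add_single (α : Fin n → ℕ) (k : Fin n) {p : (Fin n → ℝ) → ℝ}
    (hp : SmoothNear p) :
    multiDeriv (α + Pi.single k 1) p =ᶠ[𝓝 0] partialDeriv k (multiDeriv α p) :=
  listDeriv_add_single_of_mem α _ (List.nodup_finRange n) k (List.mem_finRange k) hp

theorem multiDeriv_add_single' (α : Fin n → ℕ) (k : Fin n) {p : (Fin n → ℝ) → ℝ}
    (hp : SmoothNear p) :
    multiDeriv (α + Pi.single k 1) p =ᶠ[𝓝 0] multiDeriv α (partialDeriv k p) :=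
  (multiDeriv_add_single α k hp).trans (listDeriv_partialDeriv α _ hp k).symm

theorem multiDeriv_zero (p : (Fin n → ℝ) → ℝ) : multiDeriv 0 p = p := by
  rw [multiDeriv_eq_listDeriv]
  induction List.finRange n with
  | nil => rfl
  | cons j l ih => exact ih

/-- Induction on multi-indices. -/
theorem multiIndex_induction {P : (Fin n → ℕ) → Prop} (h0 : P 0)
    (h1 : ∀ α k, P α → P (α + Pi.single k 1)) (α : Fin n → ℕ) : P α := by
  generalize hN : ∑ j, α j = N
  induction N generalizing α with
  | zero =>
    have : α = 0 := by
      funext j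
      simpa using (Finset.sum_eq_zero_iff.1 hN) j (Finset.mem_univ j)
    rwa [this]
  | succ N ih =>
    obtain ⟨k, hk⟩ : ∃ k, α k ≠ 0 := by
      by_contra! h
      simp [h] at hN
    have e : α = (α - Pi.single k 1) + Pi.single k 1 := by
      funext j
      rcases eq_or_ne j k with rfl | hjk
      · simp; omega
      · simp [Pi.single_eq_of_ne hjk]
    rw [e] at hN ⊢
    refine h1 _ k (ih _ ?_)
    simp only [Pi.add_apply, Finset.sum_add_distrib, Finset.sum_pi_single', Finset.mem_univ,
      if_true] at hN
    have : ∑ j, (Pi.single k 1 : Fin n → ℕ) j = 1 := by simp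
    omega

theorem multiDeriv_add (α : Fin n → ℕ) {p q : (Fin n → ℝ) → ℝ} (hp : SmoothNear p)
    (hq : SmoothNear q) :
    multiDeriv α (fun x => p x + q x) =ᶠ[𝓝 0] fun x => multiDeriv α p x + multiDeriv α q x := by
  induction α using multiIndex_induction with
  | h0 => simp only [multiDeriv_zero]; rfl
  | h1 α k ih =>
    filter_upwards [multiDeriv_add_single α k (hp.add hq), multiDeriv_add_single α k hp,
      multiDeriv_add_single α k hq, der_congr (V := fun _ => Pi.single k 1) ih,
      der_add (V := fun _ => Pi.single k 1) (hp.multiDeriv α) (hq.multiDeriv α)] with x a b c d e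
    rw [a, b, c]
    simp only [partialDeriv_eq_der]
    rw [d, e]

theorem multiDeriv_const_mul (α : Fin n → ℕ) (c : ℝ) {p : (Fin n → ℝ) → ℝ} (hp : SmoothNear p) :
    multiDeriv α (fun x => c * p x) =ᶠ[𝓝 0] fun x => c * multiDeriv α p x := by
  induction α using multiIndex_induction with
  | h0 => simp only [multiDeriv_zero]; rfl
  | h1 α k ih =>
    filter_upwards [multiDeriv_add_single α k (hp.const_mul c), multiDeriv_add_single α k hp,
      der_congr (V := fun _ => Pi.single k 1) ih,
      der_const_mul (V := fun _ => Pi.single k 1) c (hp.multiDeriv α)] with x a b d e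
    rw [a, b]
    simp only [partialDeriv_eq_der]
    rw [d, e]

theorem multiDeriv_zero_fun (α : Fin n → ℕ) : multiDeriv α (fun _ => 0) =ᶠ[𝓝 0] fun _ => 0 := by
  filter_upwards [multiDeriv_const_mul α 0 (smoothNear_const (n := n) (0 : ℝ))] with x hx
  simpa using hx

theorem multiDeriv_sum (α : Fin n → ℕ) {ι : Type*} (s : Finset ι) {p : ι → (Fin n → ℝ) → ℝ}
    (hp : ∀ k ∈ s, SmoothNear (p k)) :
    multiDeriv α (fun x => ∑ k ∈ s, p k x) =ᶠ[𝓝 0] fun x => ∑ k ∈ s, multiDeriv α (p k) x := by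
  classical
  induction s using Finset.induction_on with
  | empty => simpa using! multiDeriv_zero_fun α
  | insert a s ha ih =>
    simp only [Finset.sum_insert ha]
    have h2 : ∀ k ∈ s, SmoothNear (p k) := fun k hk => hp k (by simp [hk])
    filter_upwards [multiDeriv_add α (hp a (by simp)) (SmoothNear.sum s h2), ih h2] with x a b
    rw [a, b]

theorem multiDeriv_eq_zero_of_partialDeriv {p : (Fin n → ℝ) → ℝ} (hp : SmoothNear p) {k : Fin n}
    (hk : ∀ᶠ x in 𝓝 0, partialDeriv k p x = 0) {α : Fin n → ℕ} (hα : α k ≠ 0) :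
    ∀ᶠ x in 𝓝 0, multiDeriv α p x = 0 := by
  have e : α = (α - Pi.single k 1) + Pi.single k 1 := by
    funext j
    rcases eq_or_ne j k with rfl | hjk
    · simp; omega
    · simp [Pi.single_eq_of_ne hjk]
  rw [e]
  exact (multiDeriv_add_single' _ k hp).trans
    ((multiDeriv_congr _ (q := fun _ => 0) hk).trans (multiDeriv_zero_fun _))

/-- Along a line in direction `j` the function is locally constant, so its line derivative is zero.
-/
theorem DependsOnFirst.partialDeriv_eq_zero {k : ℕ} {p : (Fin n → ℝ) → ℝ} (hp : SmoothNear p)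
    (h : DependsOnFirst k p) (j : Fin n) (hj : k ≤ (j : ℕ)) :
    ∀ᶠ x in 𝓝 0, partialDeriv j p x = 0 := by
  obtain ⟨U, hU, hc⟩ := h
  filter_upwards [hp.differentiableAt, eventually_mem_nhds_iff.2 hU] with x h1 h2
  rw [partialDeriv, ← h1.lineDeriv_eq_fderiv, lineDeriv]
  have hcont : Tendsto (fun t : ℝ => x + t • (Pi.single j 1 : Fin n → ℝ)) (𝓝 0) (𝓝 x) := by
    have : Continuous fun t : ℝ => x + t • (Pi.single j 1 : Fin n → ℝ) := by fun_prop
    simpa using this.tendsto 0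
  have e : (fun t : ℝ => p (x + t • (Pi.single j 1 : Fin n → ℝ))) =ᶠ[𝓝 0] fun _ => p x := by
    filter_upwards [hcont.eventually h2] with t ht
    refine hc _ ht _ (mem_of_mem_nhds h2) fun i hi => ?_
    have : i ≠ j := by rintro rfl; omega
    simp [Pi.single_eq_of_ne this]
  rw [e.deriv_eq, deriv_const]

/-! ### Monomials -/

theorem contDiff_monomial (α : Fin n → ℕ) : ContDiff ℝ ∞ (monomial α) := by
  unfold monomial
  exact contDiff_prod fun j _ => (contDiff_apply ℝ ℝ j).pow _

theorem smoothNear_monomial (α : Fin n → ℕ) : SmoothNear (monomial α) :=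
  ContDiff.smoothNear (contDiff_monomial α)

theorem partialDeriv_monomial (α : Fin n → ℕ) (k : Fin n) :
    partialDeriv k (monomial (α + Pi.single k 1)) = fun x => ((α k : ℝ) + 1) * monomial α x := by
  funext x
  have hd := HasFDerivAt.finsetProd (𝕜 := ℝ) (u := Finset.univ) (x := x)
      (g := fun (j : Fin n) (x : Fin n → ℝ) => x j ^ (α + Pi.single k 1 : Fin n → ℕ) j)
      fun j _ => HasFDerivAt.pow (hasFDerivAt_apply (𝕜 := ℝ) j x) _
  unfold partialDeriv monomial
  rw [hd.fderiv]
  simp only [_root_.sum_apply, _root_.smul_apply,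
    ContinuousLinearMap.proj_apply]
  rw [Finset.sum_eq_single k]
  · rw [← Finset.mul_prod_erase Finset.univ (fun j => x j ^ α j) (Finset.mem_univ k)]
    have : ∏ j ∈ Finset.univ.erase k, x j ^ (α + Pi.single k 1 : Fin n → ℕ) j =
        ∏ j ∈ Finset.univ.erase k, x j ^ α j :=
      Finset.prod_congr rfl fun j hj => by
        simp [Pi.single_eq_of_ne (Finset.ne_of_mem_erase hj)]
    rw [this]
    simp
    ring
  · intro j _ hj
    simp [Pi.single_eq_of_ne hj]
  · simp

theorem multiDeriv_monomial_self (α : Fin n → ℕ) : multiDeriv α (monomial α) 0 ≠ 0 := by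
  induction α using multiIndex_induction with
  | h0 => simp [multiDeriv_zero, monomial]
  | h1 α k ih =>
    rw [(multiDeriv_add_single' α k (smoothNear_monomial _)).self_of_nhds, partialDeriv_monomial,
      (multiDeriv_const_mul α _ (smoothNear_monomial α)).self_of_nhds]
    exact mul_ne_zero (by positivity) ih

end Germs

/-! ### The order of generation of multi-indices -/

section Generation

variable {n : ℕ}

/-- All initial partial sums of `α` are at most those of `β`. -/
def SumLE (α β : Fin n → ℕ) : Prop :=
  ∀ J : Fin n, ∑ k ∈ Finset.Iic J, α k ≤ ∑ k ∈ Finset.Iic J, β k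

theorem SumLE.refl (α : Fin n → ℕ) : SumLE α α := fun _ => le_rfl

theorem SumLE.trans {α β γ : Fin n → ℕ} (h1 : SumLE α β) (h2 : SumLE β γ) : SumLE α γ :=
  fun J => (h1 J).trans (h2 J)

theorem SumLE.antisymm {α β : Fin n → ℕ} (h1 : SumLE α β) (h2 : SumLE β α) : α = β := by
  funext J
  induction J using WellFoundedLT.induction with
  | ind J ih =>
    have h := le_antisymm (h1 J) (h2 J)
    have e : ∑ k ∈ Finset.Iio J, α k = ∑ k ∈ Finset.Iio J, β k :=
      Finset.sum_congr rfl fun k hk => ih k (Finset.mem_Iio.1 hk)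
    rw [← Finset.Iio_insert, Finset.sum_insert (by simp), Finset.sum_insert (by simp), e] at h
    exact Nat.add_right_cancel h

theorem sum_Iic_add_single (α : Fin n → ℕ) (k J : Fin n) :
    ∑ j ∈ Finset.Iic J, (α + Pi.single k 1 : Fin n → ℕ) j =
      ∑ j ∈ Finset.Iic J, α j + if k ≤ J then 1 else 0 := by
  simp [Finset.sum_add_distrib]

theorem sum_eq_sum_Iic {α : Fin n → ℕ} {J : Fin n} (h : ∀ j, J < j → α j = 0) :
    ∑ j, α j = ∑ j ∈ Finset.Iic J, α j :=
  (Finset.sum_subset (Finset.subset_univ _) fun j _ hj => h j (by simpa using hj)).symm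

/-! ### Coordinate changes and their inverses -/

theorem IsCoordChange.smoothNear {T : OpenPartialHomeomorph (Fin n → ℝ) (Fin n → ℝ)}
    (hT : IsCoordChange T) : SmoothNear T := by
  filter_upwards [T.open_source.mem_nhds hT.zero_mem] with x hx
  exact hT.smooth.contDiffAt (T.open_source.mem_nhds hx)

theorem IsCoordChange.zero_mem_target {T : OpenPartialHomeomorph (Fin n → ℝ) (Fin n → ℝ)}
    (hT : IsCoordChange T) : (0 : Fin n → ℝ) ∈ T.target := by
  simpa [hT.map_zero] using T.map_source hT.zero_mem

theorem IsCoordChange.symm_zero {T : OpenPartialHomeomorph (Fin n → ℝ) (Fin n → ℝ)}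
    (hT : IsCoordChange T) : T.symm 0 = 0 := by
  simpa [hT.map_zero] using T.left_inv hT.zero_mem

theorem IsCoordChange.smoothNear_symm {T : OpenPartialHomeomorph (Fin n → ℝ) (Fin n → ℝ)}
    (hT : IsCoordChange T) : SmoothNear T.symm := by
  filter_upwards [T.open_target.mem_nhds hT.zero_mem_target] with x hx
  exact hT.smooth_symm.contDiffAt (T.open_target.mem_nhds hx)

/-- The inverse of a lower triangular Jacobian is lower triangular. Forward substitution on the rows
of the identity `U (U⁻¹ y) = y` proves it. -/
theorem IsLowerTriangularChange.partialDeriv_symm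
    {U : OpenPartialHomeomorph (Fin n → ℝ) (Fin n → ℝ)} (hU : IsLowerTriangularChange U)
    (j k : Fin n) (hjk : j < k) : ∀ᶠ y in 𝓝 0, partialDeriv k (fun y => U.symm y j) y = 0 := by
  have hV := hU.toIsCoordChange.smoothNear_symm
  have hV0 := hU.toIsCoordChange.symm_zero
  have hc : Tendsto U.symm (𝓝 0) (𝓝 0) := by
    simpa [hV0] using hV.self_of_nhds.continuousAt.tendsto
  -- Row `j` of the product of the two Jacobians; triangularity of `U` truncates the sum to `l ≤ j`.
  have key : ∀ j k : Fin n, ∀ᶠ y in 𝓝 0,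
      ∑ l ∈ Finset.Iic j, partialDeriv k (fun y => U.symm y l) y *
        partialDeriv l (fun x => U x j) (U.symm y) = if k = j then 1 else 0 := by
    intro j k
    have hz : ∀ᶠ x in 𝓝 (0 : Fin n → ℝ), ∀ l : Fin n, l ∉ Finset.Iic j →
        partialDeriv l (fun x => U x j) x = 0 := by
      refine eventually_all.2 fun l => ?_
      by_cases hl : l ≤ j
      · exact Eventually.of_forall fun x h => absurd (Finset.mem_Iic.2 hl) h
      · filter_upwards [(hU.triangular j).partialDeriv_eq_zero
          (hU.toIsCoordChange.smoothNear.apply j) l (by simpa using hl)] with x hx _ using hx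
    have hid : (fun y => U (U.symm y) j) =ᶠ[𝓝 0] fun y => y j := by
      filter_upwards [U.open_target.mem_nhds hU.toIsCoordChange.zero_mem_target] with y hy
      rw [U.right_inv hy]
    filter_upwards [der_congr (V := fun _ => Pi.single k 1) hid, hc.eventually hz,
      der_comp (V := fun _ => Pi.single k 1) hV hV0 (hU.toIsCoordChange.smoothNear.apply j)]
      with y h1 h2 h3
    rw [h3] at h1
    rw [Finset.sum_subset (Finset.subset_univ _)
      (fun l _ hl => by rw [h2 l hl, mul_zero])]
    simp only [partialDeriv_eq_der]
    refine h1.trans ?_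
    simp [der, (hasFDerivAt_apply (𝕜 := ℝ) j y).fderiv, Pi.single_apply, eq_comm]
  induction j using WellFoundedLT.induction generalizing k with
  | ind j ih =>
    have ih' : ∀ᶠ y in 𝓝 0, ∀ l : Fin n, l < j →
        partialDeriv k (fun y => U.symm y l) y = 0 ∧
          partialDeriv j (fun y => U.symm y l) y = 0 := by
      refine eventually_all.2 fun l => ?_
      by_cases hl : l < j
      · filter_upwards [ih l hl k (hl.trans hjk), ih l hl j hl] with y h1 h2 _ using ⟨h1, h2⟩
      · exact Eventually.of_forall fun x h => absurd h hl
    filter_upwards [key j k, key j j, ih'] with y h1 h2 h3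
    rw [if_neg hjk.ne', Finset.sum_eq_single_of_mem j (by simp) fun l hl hlj => by
      rw [(h3 l (lt_of_le_of_ne (by simpa using hl) hlj)).1, zero_mul]] at h1
    rw [if_pos rfl, Finset.sum_eq_single_of_mem j (by simp) fun l hl hlj => by
      rw [(h3 l (lt_of_le_of_ne (by simpa using hl) hlj)).2, zero_mul]] at h2
    -- The diagonal equation `h2` has right side `1`, so the factor it shares with `h1` is not zero.
    rcases mul_eq_zero.1 h1 with h | h
    · exact h
    · rw [h, mul_zero] at h2
      exact absurd h2 zero_ne_one

/-! ### Orders of vanishing along the first coordinates -/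

/-- `VanishingOrder J k p`: the germ `p` lies in the `k`-th power of the ideal generated by the germs
which depend on the coordinates up to `J` only and vanish at the origin. -/
inductive VanishingOrder (J : Fin n) : ℕ → ((Fin n → ℝ) → ℝ) → Prop
  | zero {p : (Fin n → ℝ) → ℝ} : SmoothNear p → VanishingOrder J 0 p
  | mul {k : ℕ} {p q : (Fin n → ℝ) → ℝ} : SmoothNear p → p 0 = 0 →
      (∀ j, J < j → ∀ᶠ x in 𝓝 0, partialDeriv j p x = 0) → VanishingOrder J k q →
      VanishingOrder J (k + 1) fun x => p x * q x
  | add {k : ℕ} {p q : (Fin n → ℝ) → ℝ} : VanishingOrder J k p → VanishingOrder J k q →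
      VanishingOrder J k fun x => p x + q x
  | congr {k : ℕ} {p q : (Fin n → ℝ) → ℝ} : VanishingOrder J k p → q =ᶠ[𝓝 0] p →
      VanishingOrder J k q

theorem VanishingOrder.smoothNear {J : Fin n} {k : ℕ} {p : (Fin n → ℝ) → ℝ}
    (h : VanishingOrder J k p) : SmoothNear p := by
  induction h with
  | zero h => exact h
  | mul hp _ _ _ ih => exact hp.mul ih
  | add _ _ ih1 ih2 => exact ih1.add ih2
  | congr _ e ih => exact ih.congr e

theorem VanishingOrder.mul_left {J : Fin n} {k : ℕ} {p r : (Fin n → ℝ) → ℝ}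
    (h : VanishingOrder J k p) (hr : SmoothNear r) : VanishingOrder J k fun x => r x * p x := by
  induction h with
  | zero h => exact .zero (hr.mul h)
  | mul hp h0 hd _ ih =>
    exact (VanishingOrder.mul hp h0 hd ih).congr (Eventually.of_forall fun x => by ring)
  | add _ _ ih1 ih2 => exact (ih1.add ih2).congr (Eventually.of_forall fun x => by ring)
  | congr _ e ih => exact ih.congr (by filter_upwards [e] with x hx; rw [hx])

theorem VanishingOrder.apply_zero {J : Fin n} {k : ℕ} {p : (Fin n → ℝ) → ℝ}
    (h : VanishingOrder J k p) (hk : k ≠ 0) : p 0 = 0 := by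
  induction h with
  | zero h => exact absurd rfl hk
  | mul hp h0 hd _ ih => simp [h0]
  | add _ _ ih1 ih2 => simp [ih1 hk, ih2 hk]
  | congr _ e ih => rw [e.self_of_nhds, ih hk]

/-- A coordinate after `J` does not occur in the generators of the ideal, so differentiating by it
costs no order. -/
theorem VanishingOrder.partialDeriv_of_lt {J : Fin n} {k : ℕ} {p : (Fin n → ℝ) → ℝ}
    (h : VanishingOrder J k p) {j : Fin n} (hj : J < j) :
    VanishingOrder J k (partialDeriv j p) := by
  induction h with
  | zero h => exact .zero (h.partialDeriv j)
  | mul hp h0 hd hq ih =>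
    refine (VanishingOrder.mul hp h0 hd ih).congr ?_
    filter_upwards [der_mul (V := fun _ => Pi.single j 1) hp hq.smoothNear, hd j hj] with x h1 h2
    rw [partialDeriv_eq_der, h1, ← partialDeriv_eq_der, ← partialDeriv_eq_der, h2]
    ring
  | add h1 h2 ih1 ih2 =>
    exact (ih1.add ih2).congr (der_add h1.smoothNear h2.smoothNear)
  | congr _ e ih => exact ih.congr (der_congr e)

/-- By Leibniz a derivative destroys at most one of the `k` vanishing factors. Truncated subtraction
covers order zero. -/
theorem VanishingOrder.partialDeriv {J : Fin n} {k : ℕ} {p : (Fin n → ℝ) → ℝ}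
    (h : VanishingOrder J k p) (j : Fin n) :
    VanishingOrder J (k - 1) (partialDeriv j p) := by
  induction h with
  | zero h => exact .zero (h.partialDeriv j)
  | @mul k p q hp h0 hd hq ih =>
    refine VanishingOrder.congr (p := fun x => p x * TriForm.partialDeriv j q x +
      TriForm.partialDeriv j p x * q x) (.add ?_ (hq.mul_left (hp.partialDeriv j)))
      (der_mul hp hq.smoothNear)
    -- In the summand where `q` is differentiated, the factor `p` restores the order lost by `q`;
    -- when `q` has order `0`, smoothness suffices.
    rcases k with _ | k
    · exact .zero (hp.mul ih.smoothNear)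
    · exact .mul hp h0 hd ih
  | add h1 h2 ih1 ih2 =>
    exact (ih1.add ih2).congr (der_add h1.smoothNear h2.smoothNear)
  | congr _ e ih => exact ih.congr (der_congr e)

theorem VanishingOrder.multiDeriv {J : Fin n} {k : ℕ} {p : (Fin n → ℝ) → ℝ}
    (h : VanishingOrder J k p) (β : Fin n → ℕ) :
    VanishingOrder J (k - ∑ j ∈ Finset.Iic J, β j) (multiDeriv β p) := by
  induction β using multiIndex_induction with
  | h0 => simpa [multiDeriv_zero] using h
  | h1 β j ih =>
    refine VanishingOrder.congr ?_ (multiDeriv_add_single β j h.smoothNear)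
    rw [sum_Iic_add_single]
    split_ifs with hj
    · rw [← Nat.sub_sub]
      exact ih.partialDeriv j
    · exact ih.partialDeriv_of_lt (not_le.1 hj)

theorem VanishingOrder.prod_pow {J : Fin n} {ι : Type*} (s : Finset ι) (a : ι → ℕ)
    {p : ι → (Fin n → ℝ) → ℝ} (hp : ∀ i ∈ s, SmoothNear (p i)) (h0 : ∀ i ∈ s, p i 0 = 0)
    (hd : ∀ i ∈ s, ∀ j, J < j → ∀ᶠ x in 𝓝 0, TriForm.partialDeriv j (p i) x = 0) :
    VanishingOrder J (∑ i ∈ s, a i) fun x => ∏ i ∈ s, p i x ^ a i := by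
  classical
  induction s using Finset.induction_on with
  | empty => simpa using VanishingOrder.zero (smoothNear_const 1)
  | insert i s hi ih =>
    simp only [Finset.sum_insert hi, Finset.prod_insert hi]
    have ih' := ih (fun i h => hp i (by simp [h])) (fun i h => h0 i (by simp [h]))
      (fun i h => hd i (by simp [h]))
    generalize a i = r
    induction r with
    | zero => simpa using ih'
    | succ r ihr =>
      rw [show r + 1 + ∑ i ∈ s, a i = (r + ∑ i ∈ s, a i) + 1 by ring]
      exact (VanishingOrder.mul (hp i (by simp)) (h0 i (by simp)) (hd i (by simp)) ihr).congr
        (Eventually.of_forall fun x => by ring)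

/-- The remainder has zero `β`-derivative at `0`, while that of `c y^β` is nonzero. Generation is
used below only through this nonvanishing. -/
theorem Generates.multiDeriv_ne_zero {α β : Fin n → ℕ} (h : Generates α β) :
    ∃ U : OpenPartialHomeomorph (Fin n → ℝ) (Fin n → ℝ), IsLowerTriangularChange U ∧
      multiDeriv β (fun y => monomial α (U.symm y)) 0 ≠ 0 := by
  obtain ⟨U, hU, c, h, hc, hh, h0, e⟩ := h
  refine ⟨U, hU, ?_⟩
  rw [(multiDeriv_congr β e).self_of_nhds,
    (multiDeriv_add β ((smoothNear_monomial β).const_mul c) hh).self_of_nhds]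
  beta_reduce
  rw [h0, (multiDeriv_const_mul β c (smoothNear_monomial β)).self_of_nhds, add_zero]
  exact mul_ne_zero hc (multiDeriv_monomial_self β)

/-- The factors of `x^α` with index up to `J` depend on `y_1, …, y_J` only and vanish at `0`. If the
`J`-th sum of `α` exceeded that of `β`, some vanishing order would survive `∂^β`. -/
theorem Generates.sumLE {α β : Fin n → ℕ} (h : Generates α β) : SumLE α β := by
  obtain ⟨U, hU, h⟩ := h.multiDeriv_ne_zero
  intro J
  by_contra! hlt
  have hV := hU.toIsCoordChange.smoothNear_symm
  have h1 : VanishingOrder J (∑ k ∈ Finset.Iic J, α k)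
      fun y => ∏ i ∈ Finset.Iic J, U.symm y i ^ α i :=
    VanishingOrder.prod_pow (p := fun i y => U.symm y i) _ _ (fun i _ => hV.apply i)
      (fun i _ => by simp [hU.toIsCoordChange.symm_zero])
      (fun i hi j hj => hU.partialDeriv_symm i j (lt_of_le_of_lt (by simpa using hi) hj))
  have h2 := h1.mul_left (r := fun y => ∏ i ∈ (Finset.Iic J)ᶜ, U.symm y i ^ α i)
    (SmoothNear.prod _ fun i _ => (hV.apply i).pow _)
  have h3 : VanishingOrder J (∑ k ∈ Finset.Iic J, α k) fun y => monomial α (U.symm y) :=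
    h2.congr (Eventually.of_forall fun y => (Finset.prod_compl_mul_prod (Finset.Iic J) _).symm)
  exact h ((h3.multiDeriv β).apply_zero (by omega))

/-- A triangular change carries functions of the first `k` coordinates to functions of the first `k`
coordinates, so `∂^β` cannot involve a later one. -/
theorem Generates.eq_zero {α β : Fin n → ℕ} (h : Generates α β) {k : ℕ}
    (hα : ∀ j : Fin n, k ≤ (j : ℕ) → α j = 0) (j : Fin n) (hj : k ≤ (j : ℕ)) : β j = 0 := by
  obtain ⟨U, hU, h⟩ := h.multiDeriv_ne_zero
  by_contra hβ
  have hV := hU.toIsCoordChange.smoothNear_symm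
  have hV0 := hU.toIsCoordChange.symm_zero
  have hc : Tendsto U.symm (𝓝 0) (𝓝 0) := by
    simpa [hV0] using hV.self_of_nhds.continuousAt.tendsto
  refine h (multiDeriv_eq_zero_of_partialDeriv ((smoothNear_monomial α).comp hV hV0)
    (k := j) ?_ hβ).self_of_nhds
  have hdep : DependsOnFirst k (monomial α) := by
    refine ⟨Set.univ, univ_mem, fun x _ y _ hxy => Finset.prod_congr rfl fun i _ => ?_⟩
    by_cases hi : (i : ℕ) < k
    · rw [hxy i hi]
    · simp [hα i (not_lt.1 hi)]
  have h1 : ∀ᶠ y in 𝓝 (0 : Fin n → ℝ), ∀ l : Fin n,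
      partialDeriv j (fun y => U.symm y l) y * partialDeriv l (monomial α) (U.symm y) = 0 := by
    refine eventually_all.2 fun l => ?_
    by_cases hl : (l : ℕ) < k
    · filter_upwards [hU.partialDeriv_symm l j (Fin.lt_def.2 (by omega))] with y hy
      rw [hy, zero_mul]
    · filter_upwards [hc.eventually (hdep.partialDeriv_eq_zero (smoothNear_monomial α) l
        (not_lt.1 hl))] with y hy
      rw [hy, mul_zero]
  filter_upwards [h1, der_comp (V := fun _ => Pi.single j 1) hV hV0 (smoothNear_monomial α)]
    with y h2 h3
  rw [partialDeriv_eq_der, h3]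
  exact Finset.sum_eq_zero fun l _ => h2 l

/-! ### The exponential change of coordinates and positivity -/

/-- The sequence `L` shifted by one place. -/
def shift (L : Fin n → ℝ) (j : Fin n) : ℝ :=
  if h : (j : ℕ) = 0 then 0 else L ⟨(j : ℕ) - 1, by omega⟩

theorem Iio_eq_Iic_pred (j : Fin n) (h : (j : ℕ) ≠ 0) :
    Finset.Iio j = Finset.Iic (⟨(j : ℕ) - 1, by omega⟩ : Fin n) := by
  ext i
  simp only [Finset.mem_Iio, Finset.mem_Iic, Fin.lt_def, Fin.le_def]
  omega

theorem Iio_eq_empty (j : Fin n) (h : (j : ℕ) = 0) : Finset.Iio j = ∅ := by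
  ext i
  simp only [Finset.mem_Iio, Fin.lt_def, Finset.notMem_empty, iff_false]
  omega

/-- The partial sums `y_1 + ⋯ + y_j`. -/
def partialSum (y : Fin n → ℝ) (j : Fin n) : ℝ := ∑ k ∈ Finset.Iic j, y k

theorem partialSum_eq_add_shift (y : Fin n → ℝ) (j : Fin n) :
    partialSum y j = y j + shift (partialSum y) j := by
  rw [partialSum, ← Finset.Iio_insert, Finset.sum_insert (by simp), shift]
  split_ifs with h
  · simp [Iio_eq_empty j h]
  · rw [Iio_eq_Iic_pred j h, partialSum]

theorem partialSum_sub_shift (L : Fin n → ℝ) (j : Fin n) :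
    partialSum (fun i => L i - shift L i) j = L j := by
  induction j using WellFoundedLT.induction with
  | ind j ih =>
    rw [partialSum_eq_add_shift]
    have : shift (partialSum fun i => L i - shift L i) j = shift L j := by
      unfold shift
      split_ifs with h
      · rfl
      · exact ih _ (Fin.lt_def.2 (by simp; omega))
    rw [this]
    ring

theorem contDiff_partialSum (j : Fin n) : ContDiff ℝ ∞ fun y : Fin n → ℝ => partialSum y j :=
  ContDiff.sum fun k _ => contDiff_apply ℝ ℝ k

/-- The change of coordinates whose inverse is `x_j = exp (y_1 + ⋯ + y_j) - 1`. -/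
noncomputable def logChange (n : ℕ) : OpenPartialHomeomorph (Fin n → ℝ) (Fin n → ℝ) where
  toFun x j := Real.log (1 + x j) - shift (fun i => Real.log (1 + x i)) j
  invFun y j := Real.exp (partialSum y j) - 1
  source := {x | ∀ j, 0 < 1 + x j}
  target := Set.univ
  map_source' _ _ := Set.mem_univ _
  map_target' y _ j := by simpa using Real.exp_pos _
  left_inv' x hx := by
    funext j
    rw [partialSum_sub_shift, Real.exp_log (hx j)]
    ring
  right_inv' y _ := by
    funext j
    simp only [add_sub_cancel, Real.log_exp]
    rw [partialSum_eq_add_shift]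
    exact add_sub_cancel_right _ _
  open_source := by
    simp only [Set.ofPred_forall]
    exact isOpen_iInter_of_finite fun j => isOpen_lt continuous_const (by fun_prop)
  open_target := isOpen_univ
  continuousOn_toFun := by
    refine continuousOn_pi.2 fun j => ContinuousOn.sub ?_ ?_
    · exact ContinuousOn.log (by fun_prop) fun x hx => (hx j).ne'
    · unfold shift
      split_ifs with h
      · exact continuousOn_const
      · exact ContinuousOn.log (by fun_prop) fun x hx => (hx _).ne'
  continuousOn_invFun := by
    refine (continuous_pi fun j => ?_).continuousOn
    exact ((Real.continuous_exp.comp (contDiff_partialSum j).continuous)).sub continuous_const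

theorem logChange_apply (x : Fin n → ℝ) (j : Fin n) :
    logChange n x j = Real.log (1 + x j) - shift (fun i => Real.log (1 + x i)) j := rfl

theorem logChange_symm_apply (y : Fin n → ℝ) (j : Fin n) :
    (logChange n).symm y j = Real.exp (partialSum y j) - 1 := rfl

theorem contDiff_logChange_symm : ContDiff ℝ ∞ (logChange n).symm :=
  contDiff_pi.2 fun j => (contDiff_partialSum j).exp.sub contDiff_const

theorem isLowerTriangularChange_logChange : IsLowerTriangularChange (logChange n) where
  zero_mem := fun j => by simp
  map_zero := by
    funext j
    simp [logChange_apply, shift]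
  smooth := by
    have hl : ∀ i : Fin n, ContDiffOn ℝ ∞ (fun x : Fin n → ℝ => Real.log (1 + x i))
        (logChange n).source := fun i =>
      (contDiffOn_const.add (contDiff_apply ℝ ℝ i).contDiffOn).log fun x hx => (hx i).ne'
    refine contDiffOn_pi.2 fun j => (hl j).sub ?_
    unfold shift
    split_ifs with h
    · exact contDiffOn_const
    · exact hl _
  smooth_symm := contDiff_logChange_symm.contDiffOn
  triangular := fun j => by
    refine ⟨Set.univ, univ_mem, fun x _ y _ hxy => ?_⟩
    simp only [logChange_apply, shift, hxy j (Nat.lt_succ_self _)]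
    split_ifs with h
    · rfl
    · rw [hxy ⟨(j : ℕ) - 1, _⟩ (by simp)]

/-- The functions `exp (∑ a_j s_j) ∏ (exp s_j - 1)^{b_j}` of the partial sums `s_j`. -/
noncomputable def expMonomial (b a : Fin n → ℕ) (y : Fin n → ℝ) : ℝ :=
  Real.exp (∑ j, a j * partialSum y j) * ∏ j, (Real.exp (partialSum y j) - 1) ^ b j

theorem smoothNear_expMonomial (b a : Fin n → ℕ) : SmoothNear (expMonomial b a) :=
  ContDiff.smoothNear <|
    (ContDiff.sum fun j _ => contDiff_const.mul (contDiff_partialSum j)).exp.mul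
      (contDiff_prod fun j _ => ((contDiff_partialSum j).exp.sub contDiff_const).pow _)

theorem expMonomial_zero (b a : Fin n → ℕ) : expMonomial b a 0 = ∏ j, (0 : ℝ) ^ b j := by
  simp [expMonomial, partialSum]

/-- The family is closed under differentiation with natural coefficients: `∂_k` of the `j`-th
partial sum is `1` for `k ≤ j` and `0` otherwise, and differentiating `exp s - 1` produces `exp s`,
recorded in `a`. Where `b - Pi.single j 1` truncates, the coefficient `b j` is zero. -/
theorem partialDeriv_expMonomial (b a : Fin n → ℕ) (k : Fin n) :
    partialDeriv k (expMonomial b a) = fun y => ∑ j, if k ≤ j then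
      a j * expMonomial b a y + b j * expMonomial (b - Pi.single j 1) (a + Pi.single j 1) y
      else 0 := by
  funext y
  have hs : ∀ j : Fin n, HasFDerivAt (fun y : Fin n → ℝ => partialSum y j)
      (∑ i ∈ Finset.Iic j, ContinuousLinearMap.proj (R := ℝ) (φ := fun _ : Fin n => ℝ) i) y :=
    fun j => HasFDerivAt.fun_sum fun i _ => hasFDerivAt_apply i y
  have h1 := (HasFDerivAt.fun_sum (u := Finset.univ)
    fun j _ => (hs j).const_mul (a j : ℝ)).exp
  have h2 := HasFDerivAt.finsetProd (𝕜 := ℝ) (u := Finset.univ) (x := y)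
      (g := fun (j : Fin n) (y : Fin n → ℝ) => (Real.exp (partialSum y j) - 1) ^ b j)
      fun j _ => HasFDerivAt.pow ((hs j).exp.sub_const 1) _
  have h3 := h1.mul h2
  have h4 : fderiv ℝ (expMonomial b a) y = _ := h3.fderiv
  rw [partialDeriv, h4]
  simp only [_root_.sum_apply, _root_.smul_apply, _root_.add_apply,
    ContinuousLinearMap.proj_apply, smul_eq_mul, Finset.sum_pi_single', Finset.mem_Iic]
  rw [Finset.mul_sum, Finset.mul_sum, Finset.mul_sum, ← Finset.sum_add_distrib]
  refine Finset.sum_congr rfl fun j _ => ?_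
  by_cases hkj : k ≤ j
  · simp only [hkj, if_true, mul_one]
    have e1 : expMonomial (b - Pi.single j 1) (a + Pi.single j 1) y =
        Real.exp (∑ j, a j * partialSum y j) * Real.exp (partialSum y j) *
          ((Real.exp (partialSum y j) - 1) ^ (b j - 1) *
            ∏ i ∈ Finset.univ.erase j, (Real.exp (partialSum y i) - 1) ^ b i) := by
      rw [expMonomial, ← Real.exp_add, ← Finset.mul_prod_erase Finset.univ _ (Finset.mem_univ j)]
      congr 1
      · congr 1
        simp [add_mul, Finset.sum_add_distrib, Pi.single_apply]
      · congr 1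
        · simp
        · refine Finset.prod_congr rfl fun i hi => ?_
          simp [Pi.single_eq_of_ne (Finset.ne_of_mem_erase hi)]
    rw [e1, expMonomial]
    simp only [nsmul_eq_mul]
    ring
  · simp [hkj]

theorem multiDeriv_add_single_expMonomial (α b a : Fin n → ℕ) (k : Fin n) :
    multiDeriv (α + Pi.single k 1) (expMonomial b a) 0 = ∑ j, if k ≤ j then
      a j * multiDeriv α (expMonomial b a) 0 +
        b j * multiDeriv α (expMonomial (b - Pi.single j 1) (a + Pi.single j 1)) 0
      else 0 := by
  rw [(multiDeriv_add_single' α k (smoothNear_expMonomial b a)).self_of_nhds,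
    partialDeriv_expMonomial, (multiDeriv_sum α Finset.univ fun j _ => ?_).self_of_nhds]
  · refine Finset.sum_congr rfl fun j _ => ?_
    split_ifs with h
    · rw [(multiDeriv_add α ((smoothNear_expMonomial _ _).const_mul _)
        ((smoothNear_expMonomial _ _).const_mul _)).self_of_nhds]
      beta_reduce
      rw [(multiDeriv_const_mul α _ (smoothNear_expMonomial _ _)).self_of_nhds,
        (multiDeriv_const_mul α _ (smoothNear_expMonomial _ _)).self_of_nhds]
    · exact (multiDeriv_zero_fun α).self_of_nhds
  · split_ifs with h
    · exact ((smoothNear_expMonomial _ _).const_mul _).add ((smoothNear_expMonomial _ _).const_mul _)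
    · exact smoothNear_const 0

theorem multiDeriv_expMonomial_nonneg (α b a : Fin n → ℕ) :
    0 ≤ multiDeriv α (expMonomial b a) 0 := by
  induction α using multiIndex_induction generalizing b a with
  | h0 =>
    rw [multiDeriv_zero, expMonomial_zero]
    exact Finset.prod_nonneg fun j _ => by positivity
  | h1 α k ih =>
    rw [multiDeriv_add_single_expMonomial]
    refine Finset.sum_nonneg fun j _ => ?_
    split_ifs with h
    · exact add_nonneg (mul_nonneg (by positivity) (ih _ _)) (mul_nonneg (by positivity) (ih _ _))
    · exact le_rfl

theorem SumLE.sum_Iio {α β : Fin n → ℕ} (h : SumLE α β) (k : Fin n) :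
    ∑ j ∈ Finset.Iio k, α j ≤ ∑ j ∈ Finset.Iio k, β j := by
  by_cases hk : (k : ℕ) = 0
  · simp [Iio_eq_empty k hk]
  · rw [Iio_eq_Iic_pred k hk]
    exact h _

/-- Induction on the order of `α`, differentiating by the last coordinate `k` that occurs in it. All
summands are nonnegative, so one positive summand is enough. The derivative removes a factor `exp
s_j - 1` with `j ≥ k` if there is one; otherwise it acts on the exponential, and `htop` supplies a
nonzero exponent. Tracking `a` preserves `htop` when a factor is removed. -/
theorem multiDeriv_expMonomial_pos (α b a : Fin n → ℕ) (hle : SumLE b α)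
    (htop : ∀ k, α k ≠ 0 → ∃ j, k ≤ j ∧ a j + b j ≠ 0) :
    0 < multiDeriv α (expMonomial b a) 0 := by
  generalize hN : ∑ j, α j = N
  induction N generalizing α b a with
  | zero =>
    have h0 : α = 0 := by
      funext j
      simpa using (Finset.sum_eq_zero_iff.1 hN) j (Finset.mem_univ j)
    have hb : b = 0 := (h0 ▸ hle).antisymm fun J => by simp
    rw [h0, hb, multiDeriv_zero, expMonomial_zero]
    simp
  | succ N ih =>
    obtain ⟨k, hk, hmax⟩ : ∃ k, α k ≠ 0 ∧ ∀ i, k < i → α i = 0 := by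
      have hne : (Finset.univ.filter fun k => α k ≠ 0).Nonempty := by
        by_contra h
        rw [Finset.not_nonempty_iff_eq_empty, Finset.filter_eq_empty_iff] at h
        rw [Finset.sum_eq_zero fun j hj => not_not.1 (h hj)] at hN
        omega
      refine ⟨Finset.max' _ hne, (Finset.mem_filter.1 (Finset.max'_mem _ hne)).2, fun i hi => ?_⟩
      by_contra h
      exact absurd (Finset.le_max' _ i (Finset.mem_filter.2 ⟨Finset.mem_univ i, h⟩)) (not_le.2 hi)
    have single_cancel : ∀ (β : Fin n → ℕ) (j : Fin n), β j ≠ 0 →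
        ∃ β', β = β' + Pi.single j 1 := fun β j hj => ⟨β - Pi.single j 1, by
      funext i
      rcases eq_or_ne i j with rfl | hij
      · simp; omega
      · simp [Pi.single_eq_of_ne hij]⟩
    obtain ⟨α', rfl⟩ := single_cancel α k hk
    have hmax' : ∀ i, k < i → α' i = 0 := fun i hi => by
      have := hmax i hi
      simp only [Pi.add_apply] at this
      omega
    have hN' : ∑ j, α' j = N := by
      simp only [Pi.add_apply, Finset.sum_add_distrib] at hN
      have : ∑ j, (Pi.single k 1 : Fin n → ℕ) j = 1 := by simp
      omega
    have hmono : ∀ (β : Fin n → ℕ) {I J : Fin n}, I ≤ J →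
        ∑ i ∈ Finset.Iic I, β i ≤ ∑ i ∈ Finset.Iic J, β i := fun β I J h =>
      Finset.sum_le_sum_of_subset (Finset.Iic_subset_Iic.2 h)
    rw [multiDeriv_add_single_expMonomial]
    have nonneg : ∀ j : Fin n, 0 ≤ (a j : ℝ) * multiDeriv α' (expMonomial b a) 0 ∧
        0 ≤ (b j : ℝ) * multiDeriv α' (expMonomial (b - Pi.single j 1) (a + Pi.single j 1)) 0 :=
      fun j => ⟨mul_nonneg (by positivity) (multiDeriv_expMonomial_nonneg _ _ _),
        mul_nonneg (by positivity) (multiDeriv_expMonomial_nonneg _ _ _)⟩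
    have sum_pos : ∀ j : Fin n, k ≤ j → (0 < (a j : ℝ) * multiDeriv α' (expMonomial b a) 0 ∨
        0 < (b j : ℝ) *
          multiDeriv α' (expMonomial (b - Pi.single j 1) (a + Pi.single j 1)) 0) →
        0 < ∑ j, if k ≤ j then a j * multiDeriv α' (expMonomial b a) 0 +
          b j * multiDeriv α' (expMonomial (b - Pi.single j 1) (a + Pi.single j 1)) 0
          else 0 := by
      intro j hkj h
      refine Finset.sum_pos' (fun i _ => ?_) ⟨j, Finset.mem_univ j, ?_⟩
      · split_ifs
        exacts [add_nonneg (nonneg i).1 (nonneg i).2, le_rfl]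
      · rw [if_pos hkj]
        rcases h with h | h
        exacts [add_pos_of_pos_of_nonneg h (nonneg j).2, add_pos_of_nonneg_of_pos (nonneg j).1 h]
    by_cases hb : ∃ j, k ≤ j ∧ b j ≠ 0
    · obtain ⟨j, hkj, hbj⟩ := hb
      refine sum_pos j hkj (Or.inr (mul_pos (by positivity) (ih _ _ _ ?_ ?_ hN')))
      · obtain ⟨b', rfl⟩ := single_cancel b j hbj
        rw [add_tsub_cancel_right]
        intro J
        have h1 := hle J
        have h2 := hle j
        rw [sum_Iic_add_single, sum_Iic_add_single] at h1 h2
        rw [if_pos le_rfl, if_pos hkj] at h2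
        by_cases hjJ : j ≤ J
        · rw [if_pos hjJ, if_pos (hkj.trans hjJ)] at h1
          omega
        · rw [if_neg hjJ] at h1
          -- For `k ≤ J < j` only `α` loses a unit in the `J`-th sum. Since `α'` vanishes after `k`,
          -- its sums up to `J` and up to `j` agree, and the inequality at `j` gives what is needed.
          split_ifs at h1 with hkJ
          · have h3 := hmono b' (not_le.1 hjJ).le
            rw [← sum_eq_sum_Iic (J := j) fun i hi => hmax' i (hkj.trans_lt hi),
              sum_eq_sum_Iic (J := J) fun i hi => hmax' i (hkJ.trans_lt hi)] at h2
            omega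
          · omega
      · intro i hi
        refine ⟨j, (not_lt.1 fun h => hi (hmax' i h)).trans hkj, ?_⟩
        simp
    · push Not at hb
      obtain ⟨j, hkj, hj⟩ := htop k hk
      rw [hb j hkj, add_zero] at hj
      refine sum_pos j hkj (Or.inl (mul_pos (by positivity) (ih _ _ _ ?_ ?_ hN')))
      · intro J
        by_cases hkJ : k ≤ J
        · have e : ∀ β : Fin n → ℕ, ∑ i ∈ Finset.Iio k, β i ≤ ∑ i ∈ Finset.Iic J, β i := fun β =>
            Finset.sum_le_sum_of_subset fun i hi =>
              Finset.mem_Iic.2 ((Finset.mem_Iio.1 hi).le.trans hkJ)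
          -- Here `b` vanishes from `k` on, so its sum up to `J` is a sum below `k`, where removing
          -- the unit from `α` changes nothing.
          calc ∑ i ∈ Finset.Iic J, b i = ∑ i ∈ Finset.Iio k, b i :=
                (Finset.sum_subset (fun i hi =>
                  Finset.mem_Iic.2 ((Finset.mem_Iio.1 hi).le.trans hkJ)) fun i _ hi =>
                    hb i (by simpa using hi)).symm
            _ ≤ ∑ i ∈ Finset.Iio k, (α' + Pi.single k 1 : Fin n → ℕ) i := hle.sum_Iio k
            _ = ∑ i ∈ Finset.Iio k, α' i := Finset.sum_congr rfl fun i hi => by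
                simp [Pi.single_eq_of_ne (Finset.mem_Iio.1 hi).ne]
            _ ≤ _ := e α'
        · have h1 := hle J
          rwa [sum_Iic_add_single, if_neg hkJ, add_zero] at h1
      · intro i hi
        exact htop i (by simp only [Pi.add_apply]; omega)

/-- In the exponential coordinates `x^α` becomes `expMonomial α 0`, whose `β`-derivative at `0` is
positive; subtracting the matching multiple of `y^β` leaves the required remainder. -/
theorem generates_of_sumLE {α β : Fin n → ℕ} (hle : SumLE α β)
    (htop : ∀ k, β k ≠ 0 → ∃ j, k ≤ j ∧ α j ≠ 0) : Generates α β := by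
  have hpos := multiDeriv_expMonomial_pos β α 0 hle (by simpa using htop)
  have hmon : ∀ y, monomial α ((logChange n).symm y) = expMonomial α 0 y := fun y => by
    simp [monomial, expMonomial, logChange_symm_apply]
  -- This ratio is the one value for which the remainder has zero `β`-derivative at the origin.
  set c := multiDeriv β (expMonomial α 0) 0 / multiDeriv β (monomial β) 0 with hc
  have hs := (smoothNear_monomial β).const_mul (-c)
  refine ⟨logChange n, isLowerTriangularChange_logChange, c,
    fun y => expMonomial α 0 y + -c * monomial β y,
    div_ne_zero hpos.ne' (multiDeriv_monomial_self β), (smoothNear_expMonomial α 0).add hs, ?_,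
    Eventually.of_forall fun y => by rw [hmon]; ring⟩
  rw [(multiDeriv_add β (smoothNear_expMonomial α 0) hs).self_of_nhds]
  beta_reduce
  rw [(multiDeriv_const_mul β (-c) (smoothNear_monomial β)).self_of_nhds, hc]
  field_simp [multiDeriv_monomial_self β]
  ring

/-- Properness provides a nonzero entry of `α` at or after every nonzero entry of `β`, which is the
side condition of `generates_of_sumLE`. -/
theorem IsProper.generates_iff {k : ℕ} {α β : Fin n → ℕ} (hα : IsProper k α)
    (hβ : ∀ j : Fin n, k ≤ (j : ℕ) → β j = 0) : Generates α β ↔ SumLE α β := by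
  refine ⟨Generates.sumLE, fun h => generates_of_sumLE h fun j hj => ?_⟩
  have hjk : (j : ℕ) < k := not_le.1 fun h => hj (hβ j h)
  obtain ⟨i, hi, hi1⟩ := hα.2 (by omega)
  exact ⟨i, Fin.le_def.2 (by omega), by omega⟩

/-- If the `k`-th entry of `α` were zero, `x^α` would involve only the coordinates before it, and so
would everything that `α` generates. -/
theorem Generates.isProper {k : ℕ} {α β : Fin n → ℕ} (h : Generates α β) (hβ : IsProper k β)
    (hα : ∀ j : Fin n, k ≤ (j : ℕ) → α j = 0) : IsProper k α := by
  refine ⟨hα, fun hk => ?_⟩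
  obtain ⟨i, hi, hi1⟩ := hβ.2 hk
  refine ⟨i, hi, Nat.one_le_iff_ne_zero.2 fun h0 => ?_⟩
  have := h.eq_zero (k := i) (fun j hj => ?_) i le_rfl
  · omega
  · rcases hj.eq_or_lt with hj | hj
    · rwa [← Fin.ext hj]
    · exact hα j (by omega)

end Generation

/-! ### Charts and the distributions which they span -/

section Chart

variable {n : ℕ}

theorem IsCoordChange.tendsto {T : OpenPartialHomeomorph (Fin n → ℝ) (Fin n → ℝ)}
    (hT : IsCoordChange T) : Tendsto T (𝓝 0) (𝓝 0) := by
  simpa [hT.map_zero] using hT.smoothNear.self_of_nhds.continuousAt.tendsto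

theorem IsCoordChange.fderiv_symm_fderiv {T : OpenPartialHomeomorph (Fin n → ℝ) (Fin n → ℝ)}
    (hT : IsCoordChange T) :
    ∀ᶠ x in 𝓝 0, ∀ v, fderiv ℝ T.symm (T x) (fderiv ℝ T x v) = v := by
  have hid : (fun x => T.symm (T x)) =ᶠ[𝓝 0] id := by
    filter_upwards [T.open_source.mem_nhds hT.zero_mem] with x hx using T.left_inv hx
  filter_upwards [hid.fderiv (𝕜 := ℝ), hT.smoothNear.differentiableAt,
    hT.tendsto.eventually hT.smoothNear_symm.differentiableAt] with x h1 h2 h3 v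
  have h4 : fderiv ℝ (fun x => T.symm (T x)) x = _ := fderiv_comp x h3 h2
  rw [h4, fderiv_id] at h1
  exact congrArg (fun A : (Fin n → ℝ) →L[ℝ] (Fin n → ℝ) => A v) h1

/-- A left inverse makes the derivative injective, hence surjective in finite dimension, so the
inverse is two-sided. -/
theorem IsCoordChange.fderiv_fderiv_symm {T : OpenPartialHomeomorph (Fin n → ℝ) (Fin n → ℝ)}
    (hT : IsCoordChange T) :
    ∀ᶠ x in 𝓝 0, ∀ v, fderiv ℝ T x (fderiv ℝ T.symm (T x) v) = v := by
  filter_upwards [hT.fderiv_symm_fderiv] with x hx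
  have hinj : Function.Injective (fderiv ℝ T x).toLinearMap := fun v w h => by
    rw [← hx v, ← hx w]
    exact congrArg _ h
  intro v
  obtain ⟨w, rfl⟩ := LinearMap.surjective_of_injective hinj v
  exact congrArg _ (hx w)

/-- The component `V(T_c)` of the vector field `V` in the chart `T`. -/
noncomputable def coordComp (T : (Fin n → ℝ) → Fin n → ℝ) (V : (Fin n → ℝ) → Fin n → ℝ) (c : Fin n) :
    (Fin n → ℝ) → ℝ :=
  der V fun x => T x c

theorem SmoothNear.coordCompField {T V : (Fin n → ℝ) → Fin n → ℝ} (hT : SmoothNear T)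
    (hV : SmoothNear V) (c : Fin n) : SmoothNear (coordComp T V c) :=
  hV.der (hT.apply c)

theorem coordComp_eq {T : (Fin n → ℝ) → Fin n → ℝ} (hT : SmoothNear T) :
    ∀ᶠ x in 𝓝 0, ∀ (V : (Fin n → ℝ) → Fin n → ℝ) (c : Fin n),
      coordComp T V c x = fderiv ℝ T x (V x) c := by
  filter_upwards [hT.differentiableAt] with x h1 V c using fderiv_coord_apply h1 _ c

theorem coordComp_lieBracket {T V W : (Fin n → ℝ) → Fin n → ℝ} (hT : SmoothNear T) (hV : SmoothNear V)
    (hW : SmoothNear W) (c : Fin n) : coordComp T (VectorField.lieBracket ℝ V W) c =ᶠ[𝓝 0]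
      fun x => der V (coordComp T W c) x - der W (coordComp T V c) x :=
  der_lieBracket hV hW (hT.apply c)

/-- The distribution spanned by the last coordinate vector fields of the chart `T`, from the `l`-th
one on (counted from `0`). -/
noncomputable def annih (T : (Fin n → ℝ) → Fin n → ℝ) (l : ℕ) (x : Fin n → ℝ) :
    Submodule ℝ (Fin n → ℝ) where
  carrier := {v | ∀ c : Fin n, (c : ℕ) < l → fderiv ℝ T x v c = 0}
  add_mem' := fun {v w} hv hw c hc => by simp [hv c hc, hw c hc]
  zero_mem' := fun c _ => by simp
  smul_mem' := fun a v hv c hc => by simp [hv c hc]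

theorem mem_annih {T : (Fin n → ℝ) → Fin n → ℝ} {l : ℕ} {x v : Fin n → ℝ} :
    v ∈ annih T l x ↔ ∀ c : Fin n, (c : ℕ) < l → fderiv ℝ T x v c = 0 := Iff.rfl

theorem annih_anti (T : (Fin n → ℝ) → Fin n → ℝ) {l k : ℕ} (h : l ≤ k) (x : Fin n → ℝ) :
    annih T k x ≤ annih T l x :=
  fun _ hv c hc => hv c (hc.trans_le h)

theorem sectionOf_annih_iff {T V : (Fin n → ℝ) → Fin n → ℝ} (hT : SmoothNear T) {l : ℕ} :
    SectionOf (annih T l) V ↔ ∀ c : Fin n, (c : ℕ) < l → ∀ᶠ x in 𝓝 0, coordComp T V c x = 0 := by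
  constructor
  · intro h c hc
    filter_upwards [h, coordComp_eq hT] with x h1 h2
    rw [h2]
    exact h1 c hc
  · intro h
    have : ∀ᶠ x in 𝓝 (0 : Fin n → ℝ), ∀ c : Fin n, (c : ℕ) < l → coordComp T V c x = 0 :=
      eventually_all.2 fun c => by
        by_cases hc : (c : ℕ) < l
        · filter_upwards [h c hc] with x hx _ using hx
        · exact Eventually.of_forall fun x h => absurd h hc
    filter_upwards [this, coordComp_eq hT] with x h1 h2 c hc
    rw [← h2]
    exact h1 c hc

theorem SectionOf.congr {D D' : (Fin n → ℝ) → Submodule ℝ (Fin n → ℝ)}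
    {V : (Fin n → ℝ) → Fin n → ℝ} (h : SectionOf D V) (e : ∀ᶠ x in 𝓝 0, D x = D' x) :
    SectionOf D' V := by
  filter_upwards [h, e] with x h1 h2
  rwa [← h2]

/-- The coordinate vector fields of the chart `T`. -/
noncomputable def coordField (T : OpenPartialHomeomorph (Fin n → ℝ) (Fin n → ℝ)) (k : Fin n)
    (x : Fin n → ℝ) : Fin n → ℝ :=
  fderiv ℝ T.symm (T x) (Pi.single k 1)

theorem IsCoordChange.smoothNear_coordField
    {T : OpenPartialHomeomorph (Fin n → ℝ) (Fin n → ℝ)} (hT : IsCoordChange T) (k : Fin n) :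
    SmoothNear (coordField T k) :=
  (hT.smoothNear_symm.fderiv_apply (smoothNear_const _)).comp hT.smoothNear hT.map_zero

theorem IsCoordChange.fderiv_coordField
    {T : OpenPartialHomeomorph (Fin n → ℝ) (Fin n → ℝ)} (hT : IsCoordChange T) :
    ∀ᶠ x in 𝓝 0, ∀ k, fderiv ℝ T x (coordField T k x) = Pi.single k 1 := by
  filter_upwards [hT.fderiv_fderiv_symm] with x hx k using hx _

theorem IsCoordChange.coordComp_coordField
    {T : OpenPartialHomeomorph (Fin n → ℝ) (Fin n → ℝ)} (hT : IsCoordChange T) (k c : Fin n) :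
    ∀ᶠ x in 𝓝 0, coordComp T (coordField T k) c x = (Pi.single k 1 : Fin n → ℝ) c := by
  filter_upwards [hT.fderiv_coordField, coordComp_eq hT.smoothNear] with x h1 h2
  rw [h2, h1]

theorem IsCoordChange.annih_frame
    {T : OpenPartialHomeomorph (Fin n → ℝ) (Fin n → ℝ)} (hT : IsCoordChange T) (l : ℕ) :
    ∀ᶠ x in 𝓝 0,
      LinearIndependent ℝ (fun k : Fin (n - l) => coordField T ⟨l + k, by omega⟩ x) ∧
      annih T l x = Submodule.span ℝ
        (Set.range fun k : Fin (n - l) => coordField T ⟨l + k, by omega⟩ x) := by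
  filter_upwards [hT.fderiv_coordField, hT.fderiv_symm_fderiv] with x h1 h2
  constructor
  · have h3 : LinearIndependent ℝ fun k : Fin n => (Pi.single k 1 : Fin n → ℝ) :=
      Pi.linearIndependent_single_one (Fin n) ℝ
    have h4 : LinearIndependent ℝ fun k : Fin (n - l) =>
        (Pi.single (⟨l + k, by omega⟩ : Fin n) 1 : Fin n → ℝ) :=
      h3.comp (fun k : Fin (n - l) => (⟨l + k, by omega⟩ : Fin n)) fun a b h => by
        simpa [Fin.ext_iff] using h
    refine LinearIndependent.of_comp (fderiv ℝ T x).toLinearMap ?_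
    have e : (fderiv ℝ T x).toLinearMap ∘
        (fun k : Fin (n - l) => coordField T ⟨l + k, by omega⟩ x) =
        fun k : Fin (n - l) => (Pi.single (⟨l + k, by omega⟩ : Fin n) 1 : Fin n → ℝ) :=
      funext fun k => h1 _
    rwa [e]
  · apply le_antisymm
    · intro v hv
      rw [← h2 v, ← Finset.univ_sum_single (fderiv ℝ T x v), map_sum]
      refine Submodule.sum_mem _ fun c _ => ?_
      by_cases hc : (c : ℕ) < l
      · rw [hv c hc, Pi.single_zero, _root_.map_zero]
        exact Submodule.zero_mem _
      · have e : (Pi.single c (fderiv ℝ T x v c) : Fin n → ℝ) =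
            (fderiv ℝ T x v c) • Pi.single c 1 := by
          rw [← Pi.single_smul, smul_eq_mul, mul_one]
        rw [e, map_smul]
        refine Submodule.smul_mem _ _ (Submodule.subset_span ⟨⟨(c : ℕ) - l, by omega⟩, ?_⟩)
        simp only [coordField]
        congr 2
        exact Fin.ext (by simp; omega)
    · rw [Submodule.span_le]
      rintro _ ⟨k, rfl⟩ c hc
      rw [h1]
      refine Pi.single_eq_of_ne (fun h => ?_) _
      rw [h] at hc
      simp at hc

theorem IsCoordChange.isInvolutiveDistribution_annih
    {T : OpenPartialHomeomorph (Fin n → ℝ) (Fin n → ℝ)} (hT : IsCoordChange T) (l : ℕ) :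
    IsInvolutiveDistribution (n - l) (annih T l) where
  frame := ⟨fun k => coordField T ⟨l + k, by omega⟩, fun k => hT.smoothNear_coordField _,
    hT.annih_frame l⟩
  involutive := fun V W hV hW hDV hDW => by
    rw [sectionOf_annih_iff hT.smoothNear] at hDV hDW ⊢
    intro c hc
    filter_upwards [coordComp_lieBracket hT.smoothNear hV hW c,
      der_eq_zero_of_eventuallyEq_const (V := V) (hDW c hc),
      der_eq_zero_of_eventuallyEq_const (V := W) (hDV c hc)] with x h1 h2 h3
    rw [h1, h2, h3, sub_zero]

theorem IsInvolutiveDistribution.finrank_eq {d : ℕ}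
    {D : (Fin n → ℝ) → Submodule ℝ (Fin n → ℝ)} (hD : IsInvolutiveDistribution d D) :
    ∀ᶠ x in 𝓝 0, Module.finrank ℝ (D x) = d := by
  obtain ⟨V, -, h⟩ := hD.frame
  filter_upwards [h] with x ⟨h1, h2⟩
  rw [h2, finrank_span_eq_card h1, Fintype.card_fin]

/-- The local form of the fact that an open dense set and a dense set have dense intersection. -/
theorem closure_inter_mem_nhds {X : Type*} [TopologicalSpace X] {a : X} {s t : Set X}
    (hs : IsOpen s) (has : closure s ∈ 𝓝 a) (hat : closure t ∈ 𝓝 a) :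
    closure (s ∩ t) ∈ 𝓝 a := by
  filter_upwards [has, eventually_mem_nhds_iff.2 hat] with x h1 h2
  rw [mem_closure_iff]
  intro o ho hx
  obtain ⟨y, ⟨hyo, hyt⟩, hys⟩ := mem_closure_iff.1 h1 (o ∩ interior (closure t))
    (ho.inter isOpen_interior) ⟨hx, mem_interior_iff_mem_nhds.2 h2⟩
  obtain ⟨z, ⟨hzo, hzs⟩, hzt⟩ := mem_closure_iff.1 (interior_subset hyt) (o ∩ s) (ho.inter hs)
    ⟨hyo, hys⟩
  exact ⟨z, hzo, hzs, hzt⟩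

theorem SmoothNear.eventually_eq_zero {p : (Fin n → ℝ) → ℝ} (hp : SmoothNear p)
    {s : Set (Fin n → ℝ)} (hs : closure s ∈ 𝓝 (0 : Fin n → ℝ))
    (h : ∀ᶠ x in 𝓝 0, x ∈ s → p x = 0) : ∀ᶠ x in 𝓝 0, p x = 0 := by
  filter_upwards [hp, hs, h.eventually_nhds] with x h1 h2 h3
  by_contra hx
  obtain ⟨y, hy, hy1, hy2⟩ := ((mem_closure_iff_frequently.1 h2).and_eventually
    ((h1.continuousAt.eventually_ne hx).and h3)).exists
  exact hy1 (hy2 hy)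

end Chart

/-! ### Triangular charts and uniqueness of the flag -/

section TriangularChart

variable {m : ℕ}

/-- In the chart `T`, the system `ξ̇ = F + G u` is lower triangular, with the same drift as `f` up to
the last component. -/
structure IsTriangularChart (F G f : (Fin (m + 1) → ℝ) → (Fin (m + 1) → ℝ))
    (T : OpenPartialHomeomorph (Fin (m + 1) → ℝ) (Fin (m + 1) → ℝ)) : Prop
    extends IsCoordChange T where
  smooth_F : SmoothNear F
  smooth_f : SmoothNear f
  drift : ∀ i : Fin m, ∀ᶠ x in 𝓝 0, coordComp T F i.castSucc x = f (T x) i.castSucc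
  input : ∀ i : Fin m, ∀ᶠ x in 𝓝 0, coordComp T G i.castSucc x = 0
  input_last : ∀ᶠ x in 𝓝 0, coordComp T G (Fin.last m) x ≠ 0
  triangular : ∀ i : Fin m, DependsOnFirst ((i : ℕ) + 2) (fun x => f x i.castSucc)

/-- The input enters only the last equation, so feedback leaves all other components of the drift in
the chart unchanged. -/
theorem FeedbackEquivalent.exists_isTriangularChart
    {F G f g : (Fin (m + 1) → ℝ) → (Fin (m + 1) → ℝ)} (hF : SmoothNear F)
    (hfg : IsLowerTriangularForm f g) (h : FeedbackEquivalent F G f g) :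
    ∃ T, IsTriangularChart F G f T := by
  obtain ⟨a, b, T, -, hb, hb0, hT, he⟩ := h
  have hbne : ∀ᶠ x in 𝓝 0, b x ≠ 0 := hb.self_of_nhds.continuousAt.eventually_ne hb0
  have hin : ∀ i : Fin m, ∀ᶠ x in 𝓝 0, coordComp T G i.castSucc x = 0 := fun i => by
    filter_upwards [he, hbne, hT.tendsto.eventually (hfg.input_eq_zero i), coordComp_eq hT.smoothNear]
      with x h1 h2 h3 h4
    have h5 := congrFun h1.2 i.castSucc
    rw [h3, map_smul, Pi.smul_apply, smul_eq_mul, ← h4] at h5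
    exact (mul_eq_zero.1 h5).resolve_left h2
  refine ⟨T, hT, hF, hfg.smooth_drift, fun i => ?_, hin, ?_, hfg.triangular⟩
  · filter_upwards [he, hin i, coordComp_eq hT.smoothNear] with x h1 h2 h4
    have h5 := congrFun h1.1 i.castSucc
    rw [map_add, map_smul, Pi.add_apply, Pi.smul_apply, ← h4, ← h4, h2, smul_zero, add_zero] at h5
    exact h5
  · have hlast : ∀ᶠ x in 𝓝 0, g x (Fin.last m) ≠ 0 :=
      (hfg.smooth_input.apply _).self_of_nhds.continuousAt.eventually_ne hfg.input_last_ne_zero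
    filter_upwards [he, hT.tendsto.eventually hlast, coordComp_eq hT.smoothNear] with x h1 h2 h4 h0
    have h5 := congrFun h1.2 (Fin.last m)
    rw [map_smul, Pi.smul_apply, ← h4, h0, smul_zero] at h5
    exact h2 h5.symm

variable {F G f : (Fin (m + 1) → ℝ) → (Fin (m + 1) → ℝ)}
  {T : OpenPartialHomeomorph (Fin (m + 1) → ℝ) (Fin (m + 1) → ℝ)}

/-- The component does not depend on coordinates after `i.succ`, and `H` has no components before
it, so the chain rule leaves one term. -/
theorem IsTriangularChart.der_drift (hT : IsTriangularChart F G f T) {i : Fin m}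
    {H : (Fin (m + 1) → ℝ) → (Fin (m + 1) → ℝ)}
    (h0 : ∀ c : Fin (m + 1), (c : ℕ) < (i : ℕ) + 1 → ∀ᶠ x in 𝓝 0, coordComp T H c x = 0) :
    der H (coordComp T F i.castSucc) =ᶠ[𝓝 0]
      fun x => coordComp T H i.succ x * partialDeriv i.succ (fun x => f x i.castSucc) (T x) := by
  have h1 : ∀ᶠ x in 𝓝 (0 : Fin (m + 1) → ℝ), ∀ k : Fin (m + 1), k ≠ i.succ →
      coordComp T H k x * partialDeriv k (fun x => f x i.castSucc) (T x) = 0 := by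
    refine eventually_all.2 fun k => ?_
    by_cases hk : (k : ℕ) < (i : ℕ) + 1
    · filter_upwards [h0 k hk] with x hx _
      rw [hx, zero_mul]
    by_cases hk' : k = i.succ
    · exact Eventually.of_forall fun x h => absurd hk' h
    · have : (i : ℕ) + 2 ≤ k := by
        have : (k : ℕ) ≠ i + 1 := fun h => hk' (Fin.ext (by simpa using h))
        omega
      filter_upwards [hT.tendsto.eventually
        ((hT.triangular i).partialDeriv_eq_zero (hT.smooth_f.apply _) k this)] with x hx _
      rw [hx, mul_zero]
  refine (der_congr (V := H) (hT.drift i)).trans ?_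
  filter_upwards [h1, der_comp (V := H) hT.toIsCoordChange.smoothNear hT.map_zero
    (hT.smooth_f.apply i.castSucc)] with x h2 h3
  rw [h3]
  exact Finset.sum_eq_single_of_mem i.succ (Finset.mem_univ _) fun k _ hk => h2 k hk

theorem IsTriangularChart.coordComp_lieBracket_drift (hT : IsTriangularChart F G f T) {i : Fin m}
    {H : (Fin (m + 1) → ℝ) → (Fin (m + 1) → ℝ)} (hH : SmoothNear H)
    (h0 : ∀ c : Fin (m + 1), (c : ℕ) < (i : ℕ) + 1 → ∀ᶠ x in 𝓝 0, coordComp T H c x = 0) :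
    coordComp T (VectorField.lieBracket ℝ H F) i.castSucc =ᶠ[𝓝 0]
      fun x => coordComp T H i.succ x * partialDeriv i.succ (fun x => f x i.castSucc) (T x) := by
  filter_upwards [coordComp_lieBracket hT.toIsCoordChange.smoothNear hH hT.smooth_F i.castSucc,
    hT.der_drift h0, der_eq_zero_of_eventuallyEq_const (V := F) (h0 i.castSucc (by simp))]
    with x h1 h2 h3
  rw [h1, h2, h3, sub_zero]

theorem IsTriangularChart.coordComp_lieBracket_drift_eq_zero (hT : IsTriangularChart F G f T) {i : Fin m}
    {H : (Fin (m + 1) → ℝ) → (Fin (m + 1) → ℝ)} (hH : SmoothNear H)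
    (h0 : ∀ c : Fin (m + 1), (c : ℕ) < (i : ℕ) + 1 → ∀ᶠ x in 𝓝 0, coordComp T H c x = 0)
    (c : Fin (m + 1)) (hc : (c : ℕ) < i) :
    ∀ᶠ x in 𝓝 0, coordComp T (VectorField.lieBracket ℝ H F) c x = 0 := by
  obtain ⟨d, rfl⟩ : ∃ d : Fin m, d.castSucc = c := ⟨⟨c, by omega⟩, rfl⟩
  have hd : (d : ℕ) < i := hc
  filter_upwards [hT.coordComp_lieBracket_drift (i := d) hH fun c hc => h0 c (by omega),
    h0 d.succ (by simpa using hd)] with x h1 h2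
  rw [h1, h2, zero_mul]

theorem IsTriangularChart.annih_last (hT : IsTriangularChart F G f T) :
    ∀ᶠ x in 𝓝 0, annih T m x = Submodule.span ℝ {G x} := by
  filter_upwards [eventually_all.2 hT.input, hT.input_last, hT.fderiv_symm_fderiv,
    coordComp_eq hT.toIsCoordChange.smoothNear] with x h1 h2 h3 h4
  apply le_antisymm
  · intro v hv
    rw [Submodule.mem_span_singleton]
    refine ⟨fderiv ℝ T x v (Fin.last m) / coordComp T G (Fin.last m) x, ?_⟩
    rw [← h3 v, ← h3 (G x), ← map_smul]
    congr 1
    funext c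
    induction c using Fin.lastCases with
    | last =>
      rw [Pi.smul_apply, ← h4 G, smul_eq_mul, div_mul_cancel₀ _ h2, h3]
    | cast i =>
      rw [Pi.smul_apply, ← h4 G, h1, smul_zero, hv _ (by simp)]
  · rw [Submodule.span_singleton_le_iff_mem]
    intro c hc
    rw [← h4]
    exact h1 ⟨c, hc⟩

theorem IsCoordChange.annih_top (hT : IsCoordChange T) :
    ∀ᶠ x in 𝓝 0, annih T (m + 1) x = ⊥ := by
  filter_upwards [hT.fderiv_symm_fderiv] with x hx
  refine (Submodule.eq_bot_iff _).2 fun v hv => ?_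
  rw [← hx v, show fderiv ℝ T x v = 0 from funext fun c => hv c c.isLt, _root_.map_zero]

/-- Descending induction. Where `D i` agrees with `Dhat i` and `D (i + 1)` with `Dhat (i + 1)`, the
bracket with `F` stays in `annih T i`, so `D i` is contained in it. Density and continuity extend
the inclusion to a neighbourhood, and equal dimensions give equality. -/
theorem IsTriangularChart.eq_annih (hT : IsTriangularChart F G f T)
    {D : ℕ → (Fin (m + 1) → ℝ) → Submodule ℝ (Fin (m + 1) → ℝ)} (hD : IsTriangularFlag F G D)
    {l : ℕ} (hl : l ≤ m + 1) : ∀ᶠ x in 𝓝 0, D l x = annih T l x := by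
  obtain ⟨htop, hlast, hinv, H, Dhat, hhat, hstep⟩ := hD
  have hTs := hT.toIsCoordChange.smoothNear
  -- The set `O` is part of the claim because `Dhat i` is built from `Dhat (i + 1)`, which is
  -- comparable with `D (i + 1)` only there.
  have key : ∀ k i, i + k = m → (∀ᶠ x in 𝓝 0, D i x = annih T i x) ∧
      ∃ O : Set (Fin (m + 1) → ℝ), IsOpen O ∧ closure O ∈ 𝓝 (0 : Fin (m + 1) → ℝ) ∧
        ∀ᶠ x in 𝓝 0, x ∈ O → D i x = Dhat i x := by
    intro k
    induction k with
    | zero =>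
      rintro i rfl
      refine ⟨?_, Set.univ, isOpen_univ, by simp, ?_⟩
      · filter_upwards [hlast, hT.annih_last] with x h1 h2
        simp only [add_zero] at h2
        rw [h2]
        exact h1
      · filter_upwards [hlast] with x h1 _
        exact h1.trans (hhat x).symm
    | succ k ih =>
      intro i hik
      obtain ⟨h1, O, hO, hO0, hDO⟩ := ih (i + 1) (by omega)
      obtain ⟨hH, hHD, -, hDi, O', hO', hO'0, hDO'⟩ := hstep i (by omega)
      have hHc := (sectionOf_annih_iff hTs).1 (hHD.congr h1)
      have hbr : SectionOf (annih T i) (VectorField.lieBracket ℝ (H (i + 1)) F) :=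
        (sectionOf_annih_iff hTs).2 fun c hc =>
          hT.coordComp_lieBracket_drift_eq_zero (i := ⟨i, by omega⟩) hH hHc c hc
      have hle : ∀ᶠ x in 𝓝 0, x ∈ O ∩ O' → D i x ≤ annih T i x := by
        filter_upwards [hbr, h1, hDO] with x a b c ⟨hx, hx'⟩
        rw [hDO' x hx', hDi, ← c hx, b]
        exact sup_le ((Submodule.span_singleton_le_iff_mem _ _).2 a)
          (annih_anti _ (Nat.le_succ i) x)
      obtain ⟨V, hV, hVD⟩ := (hinv i (by omega)).frame
      have hVs : ∀ k, SectionOf (annih T i) (V k) := fun k =>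
        (sectionOf_annih_iff hTs).2 fun c hc => by
          refine (hTs.coordCompField (hV k) c).eventually_eq_zero
            (closure_inter_mem_nhds hO hO0 hO'0) ?_
          filter_upwards [hle, hVD, coordComp_eq hTs] with x a b d hx
          rw [d]
          refine a hx ?_ c hc
          rw [b.2]
          exact Submodule.subset_span ⟨k, rfl⟩
      refine ⟨?_, O', hO', hO'0, Eventually.of_forall hDO'⟩
      filter_upwards [eventually_all.2 hVs, hVD, (hinv i (by omega)).finrank_eq,
        (hT.isInvolutiveDistribution_annih i).finrank_eq] with x a b c d
      refine Submodule.eq_of_le_of_finrank_eq ?_ (c.trans d.symm)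
      rw [b.2, Submodule.span_le]
      rintro _ ⟨k, rfl⟩
      exact a k
  rcases Nat.lt_or_ge m l with h | h
  · obtain rfl : l = m + 1 := by omega
    filter_upwards [htop, hT.annih_top] with x h1 h2
    rw [h1, h2]
  · exact (key (m - l) l (by omega)).1

end TriangularChart

/-! ### Iterated brackets with an adapted tuple -/

section Brackets

/-- Elimination: subtracting a multiple of `X k` clears the component `k` of `v` without disturbing
earlier ones. It extends pointwise identities from the frame `X` to the whole distribution. -/
theorem eq_zero_of_triangular {n : ℕ} {E : Type*} [AddCommGroup E] [Module ℝ E]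
    (A : E →ₗ[ℝ] (Fin n → ℝ)) (hA : Function.Injective A) (X : Fin n → E)
    (hX : ∀ l c, c < l → A (X l) c = 0) (hX' : ∀ l, A (X l) l ≠ 0) (φ : E →ₗ[ℝ] ℝ) (k : ℕ)
    (hφ : ∀ l : Fin n, k ≤ (l : ℕ) → φ (X l) = 0) (v : E) (hv : ∀ c : Fin n, (c : ℕ) < k → A v c = 0) :
    φ v = 0 := by
  generalize hd : n - k = d
  induction d generalizing k v with
  | zero =>
    have : A v = 0 := funext fun c => hv c (by omega)
    rw [hA (this.trans (map_zero A).symm), map_zero]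
  | succ d ih =>
    have hk : k < n := by omega
    set a := A v ⟨k, hk⟩ / A (X ⟨k, hk⟩) ⟨k, hk⟩ with ha
    have h1 : φ (v - a • X ⟨k, hk⟩) = 0 := by
      refine ih (k + 1) (fun l hl => hφ l (by omega)) _ (fun c hc => ?_) (by omega)
      rw [map_sub, map_smul, Pi.sub_apply, Pi.smul_apply, smul_eq_mul]
      rcases Nat.lt_succ_iff_lt_or_eq.1 hc with h | h
      · rw [hv c h, hX _ c (Fin.lt_def.2 h), mul_zero, sub_zero]
      · obtain rfl : c = ⟨k, hk⟩ := Fin.ext h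
        rw [ha, div_mul_cancel₀ _ (hX' _), sub_self]
    rwa [map_sub, map_smul, hφ _ le_rfl, smul_zero, sub_zero] at h1

/-- `LowerOrder T p Q R`: near the origin, `R` is a combination, with smooth coefficients, of the
functions `(∂^β p) ∘ T` with `Q β`. -/
inductive LowerOrder {n : ℕ} (T : (Fin n → ℝ) → Fin n → ℝ) (p : (Fin n → ℝ) → ℝ)
    (Q : (Fin n → ℕ) → Prop) : ((Fin n → ℝ) → ℝ) → Prop
  | zero : LowerOrder T p Q fun _ => 0
  | term {r : (Fin n → ℝ) → ℝ} {β : Fin n → ℕ} : SmoothNear r → Q β →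
      LowerOrder T p Q fun x => r x * multiDeriv β p (T x)
  | add {R S : (Fin n → ℝ) → ℝ} : LowerOrder T p Q R → LowerOrder T p Q S →
      LowerOrder T p Q fun x => R x + S x
  | congr {R S : (Fin n → ℝ) → ℝ} : LowerOrder T p Q R → S =ᶠ[𝓝 0] R → LowerOrder T p Q S

/-! ### Differentiating combinations of derivatives -/

section LowerOrder

variable {n : ℕ} {T : (Fin n → ℝ) → Fin n → ℝ} {p : (Fin n → ℝ) → ℝ} {Q : (Fin n → ℕ) → Prop}
  {R : (Fin n → ℝ) → ℝ}

theorem LowerOrder.mono (h : LowerOrder T p Q R) {Q' : (Fin n → ℕ) → Prop} (hQ : ∀ β, Q β → Q' β) :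
    LowerOrder T p Q' R := by
  induction h with
  | zero => exact .zero
  | term hr hβ => exact .term hr (hQ _ hβ)
  | add _ _ h1 h2 => exact h1.add h2
  | congr _ e h => exact h.congr e

theorem LowerOrder.smoothNear (h : LowerOrder T p Q R) (hT : SmoothNear T) (h0 : T 0 = 0)
    (hp : SmoothNear p) : SmoothNear R := by
  induction h with
  | zero => exact smoothNear_const 0
  | term hr hβ => exact hr.mul ((hp.multiDeriv _).comp hT h0)
  | add _ _ h1 h2 => exact h1.add h2
  | congr _ e h => exact h.congr e

theorem LowerOrder.mul_left (h : LowerOrder T p Q R) {r : (Fin n → ℝ) → ℝ} (hr : SmoothNear r) :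
    LowerOrder T p Q fun x => r x * R x := by
  induction h with
  | zero => exact LowerOrder.zero.congr (Eventually.of_forall fun x => mul_zero _)
  | term hs hβ =>
    exact (LowerOrder.term (hr.mul hs) hβ).congr (Eventually.of_forall fun x => by ring)
  | add _ _ h1 h2 => exact (h1.add h2).congr (Eventually.of_forall fun x => by ring)
  | congr _ e h => exact h.congr (by filter_upwards [e] with x hx; rw [hx])

theorem LowerOrder.apply_zero (h : LowerOrder T p Q R) (h0 : T 0 = 0)
    (hQ : ∀ β, Q β → multiDeriv β p 0 = 0) : R 0 = 0 := by
  induction h with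
  | zero => rfl
  | term hr hβ => simp only [h0, hQ _ hβ, mul_zero]
  | add _ _ h1 h2 => simp only [h1, h2, add_zero]
  | congr _ e h => rw [e.self_of_nhds, h]

theorem LowerOrder.sum {ι : Type*} (s : Finset ι) {R : ι → (Fin n → ℝ) → ℝ}
    (h : ∀ k ∈ s, LowerOrder T p Q (R k)) : LowerOrder T p Q fun x => ∑ k ∈ s, R k x := by
  classical
  induction s using Finset.induction_on with
  | empty => simpa using LowerOrder.zero
  | insert a s ha ih =>
    simp only [Finset.sum_insert ha]
    exact (h a (by simp)).add (ih fun k hk => h k (by simp [hk]))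

theorem der_multiDeriv_comp (hT : SmoothNear T) (h0 : T 0 = 0) (hp : SmoothNear p)
    (V : (Fin n → ℝ) → Fin n → ℝ) (β : Fin n → ℕ) :
    der V (fun x => multiDeriv β p (T x)) =ᶠ[𝓝 0]
      fun x => ∑ k, coordComp T V k x * multiDeriv (β + Pi.single k 1) p (T x) := by
  have hc : Tendsto T (𝓝 0) (𝓝 0) := by
    simpa [h0] using hT.self_of_nhds.continuousAt.tendsto
  have h1 : ∀ᶠ x in 𝓝 (0 : Fin n → ℝ), ∀ k : Fin n,
      multiDeriv (β + Pi.single k 1) p x = partialDeriv k (multiDeriv β p) x :=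
    eventually_all.2 fun k => multiDeriv_add_single β k hp
  filter_upwards [der_comp (V := V) hT h0 (hp.multiDeriv β), hc.eventually h1] with x h2 h3
  rw [h2]
  exact Finset.sum_congr rfl fun k _ => by rw [h3]; rfl

theorem LowerOrder.coordComp_term (hT : SmoothNear T)
    {V : (Fin n → ℝ) → Fin n → ℝ} (hV : SmoothNear V) {j : Fin n}
    (hVj : ∀ k < j, ∀ᶠ x in 𝓝 0, coordComp T V k x = 0) {β : Fin n → ℕ} {k : Fin n}
    (hQ : j ≤ k → Q (β + Pi.single k 1)) : LowerOrder T p Q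
      fun x => coordComp T V k x * multiDeriv (β + Pi.single k 1) p (T x) := by
  by_cases hk : j ≤ k
  · exact .term (hT.coordCompField hV k) (hQ hk)
  · refine LowerOrder.zero.congr ?_
    filter_upwards [hVj k (not_le.1 hk)] with x hx
    rw [hx, zero_mul]

/-- By Leibniz, differentiating a coefficient keeps `β`, and differentiating `(∂^β p) ∘ T` along `V`
adds a unit at some `k`; only `k ≥ j` contribute because the earlier components of `V` vanish. -/
theorem LowerOrder.der (h : LowerOrder T p Q R) (hT : SmoothNear T) (h0 : T 0 = 0)
    (hp : SmoothNear p) {V : (Fin n → ℝ) → Fin n → ℝ} (hV : SmoothNear V) {j : Fin n}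
    (hVj : ∀ k < j, ∀ᶠ x in 𝓝 0, coordComp T V k x = 0) {Q' : (Fin n → ℕ) → Prop}
    (hQ : ∀ β, Q β → Q' β ∧ ∀ k, j ≤ k → Q' (β + Pi.single k 1)) :
    LowerOrder T p Q' (der V R) := by
  induction h with
  | zero =>
    rw [der_const]
    exact .zero
  | @term r β hr hβ =>
    refine ((LowerOrder.sum Finset.univ fun k _ => LowerOrder.coordComp_term hT hV hVj
      ((hQ β hβ).2 k)).mul_left hr |>.add (.term (hV.der hr) (hQ β hβ).1)).congr ?_
    filter_upwards [der_mul (V := V) hr ((hp.multiDeriv β).comp hT h0),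
      der_multiDeriv_comp hT h0 hp V β] with x h1 h2
    rw [h1, h2]
  | add h1 h2 ih1 ih2 =>
    exact (ih1.add ih2).congr (der_add (h1.smoothNear hT h0 hp) (h2.smoothNear hT h0 hp))
  | congr _ e ih => exact ih.congr (der_congr e)

end LowerOrder

/-! ### Leading terms in the strict order -/

variable {m : ℕ}

/-- `β` strictly precedes `γ` in the order of generation, and its entry at `t` is not zero. -/
def PrecedesAt (t : Fin (m + 1)) (γ β : Fin (m + 1) → ℕ) : Prop :=
  SumLE β γ ∧ β ≠ γ ∧ β t ≠ 0

/-- A unit placed further to the right enters fewer initial sums. -/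
theorem SumLE.add_single {β γ : Fin (m + 1) → ℕ} (h : SumLE β γ) {j k : Fin (m + 1)} (hjk : j ≤ k) :
    SumLE (β + Pi.single k 1) (γ + Pi.single j 1) := fun J => by
  rw [sum_Iic_add_single, sum_Iic_add_single]
  have := h J
  by_cases hk : k ≤ J
  · rw [if_pos hk, if_pos (hjk.trans hk)]
    omega
  · rw [if_neg hk]
    omega

theorem sumLE_add_single (γ : Fin (m + 1) → ℕ) (j : Fin (m + 1)) : SumLE γ (γ + Pi.single j 1) :=
  fun J => by rw [sum_Iic_add_single]; omega

theorem precedesAt_add_single {t : Fin (m + 1)} {γ : Fin (m + 1) → ℕ} (h : γ t ≠ 0)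
    (j : Fin (m + 1)) : PrecedesAt t (γ + Pi.single j 1) γ :=
  ⟨sumLE_add_single γ j, fun e => by simpa using congrFun e j, h⟩

theorem precedesAt_add_single_add_single {t : Fin (m + 1)} {γ : Fin (m + 1) → ℕ} (h : γ t ≠ 0)
    {j k : Fin (m + 1)} (hjk : j < k) :
    PrecedesAt t (γ + Pi.single j 1) (γ + Pi.single k 1) :=
  ⟨(SumLE.refl γ).add_single hjk.le, fun e => by
    simpa [Pi.single_eq_of_ne hjk.ne] using congrFun e j, by simp [h]⟩

theorem PrecedesAt.add_single {t : Fin (m + 1)} {β γ : Fin (m + 1) → ℕ} (h : PrecedesAt t γ β)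
    {j k : Fin (m + 1)} (hjk : j ≤ k) :
    PrecedesAt t (γ + Pi.single j 1) (β + Pi.single k 1) := by
  refine ⟨h.1.add_single hjk, fun e => h.2.1 (h.1.antisymm fun J => ?_), by simp [h.2.2]⟩
  have h1 : ∑ i ∈ Finset.Iic J, (β + Pi.single k 1 : Fin (m + 1) → ℕ) i =
    ∑ i ∈ Finset.Iic J, (γ + Pi.single j 1 : Fin (m + 1) → ℕ) i := by rw [e]
  rw [sum_Iic_add_single, sum_Iic_add_single] at h1
  by_cases hk : k ≤ J
  · rw [if_pos hk, if_pos (hjk.trans hk)] at h1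
    omega
  · rw [if_neg hk] at h1
    omega

theorem PrecedesAt.add_single_left {t : Fin (m + 1)} {β γ : Fin (m + 1) → ℕ}
    (h : PrecedesAt t γ β) (j : Fin (m + 1)) : PrecedesAt t (γ + Pi.single j 1) β := by
  refine ⟨h.1.trans (sumLE_add_single γ j), ?_, h.2.2⟩
  rintro rfl
  have := h.1 j
  rw [sum_Iic_add_single, if_pos le_rfl] at this
  omega

/-- The component `i` of `W` is, up to terms of lower order, a multiple of `(∂^γ p) ∘ T`, and the
components before `i` vanish. -/
structure HasLeadingTerm (T : (Fin (m + 1) → ℝ) → Fin (m + 1) → ℝ) (p : (Fin (m + 1) → ℝ) → ℝ)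
    (i : Fin m) (γ : Fin (m + 1) → ℕ) (W : (Fin (m + 1) → ℝ) → Fin (m + 1) → ℝ) : Prop where
  smooth : SmoothNear W
  eq_zero : ∀ c : Fin (m + 1), (c : ℕ) < i → ∀ᶠ x in 𝓝 0, coordComp T W c x = 0
  proper : γ i.succ ≠ 0
  leading : ∃ a R : (Fin (m + 1) → ℝ) → ℝ, SmoothNear a ∧ a 0 ≠ 0 ∧
    LowerOrder T p (PrecedesAt i.succ γ) R ∧
    coordComp T W i.castSucc =ᶠ[𝓝 0] fun x => a x * multiDeriv γ p (T x) + R x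

/-- The conditions on an adapted tuple in terms of a chart. -/
structure IsChartTuple (T : (Fin (m + 1) → ℝ) → Fin (m + 1) → ℝ) (i : Fin m)
    (Y : Fin (m + 1) → (Fin (m + 1) → ℝ) → (Fin (m + 1) → ℝ)) : Prop where
  smooth : ∀ j ≤ i.succ, SmoothNear (Y j)
  eq_zero : ∀ j ≤ i.succ, ∀ c < j, ∀ᶠ x in 𝓝 0, coordComp T (Y j) c x = 0
  ne_zero : ∀ j ≤ i.succ, coordComp T (Y j) j 0 ≠ 0
  /-- the derivatives of the components of `Y` along fields whose components before `i` vanish -/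
  der_eq_zero : ∀ j ≤ i.succ, ∀ W : (Fin (m + 1) → ℝ) → Fin (m + 1) → ℝ,
    (∀ c : Fin (m + 1), (c : ℕ) < i → ∀ᶠ x in 𝓝 0, coordComp T W c x = 0) →
    ∀ c : Fin (m + 1), (c : ℕ) < i → ∀ᶠ x in 𝓝 0, der W (coordComp T (Y j) c) x = 0
  der_eq_mul : ∀ j ≤ i.succ, ∃ μ : (Fin (m + 1) → ℝ) → ℝ, SmoothNear μ ∧
    ∀ W : (Fin (m + 1) → ℝ) → Fin (m + 1) → ℝ,
      (∀ c : Fin (m + 1), (c : ℕ) < i → ∀ᶠ x in 𝓝 0, coordComp T W c x = 0) →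
      ∀ᶠ x in 𝓝 0, der W (coordComp T (Y j) i.castSucc) x = μ x * coordComp T W i.castSucc x

/-! ### Leading terms of brackets with a tuple -/

variable {F G f : (Fin (m + 1) → ℝ) → (Fin (m + 1) → ℝ)}
  {T : OpenPartialHomeomorph (Fin (m + 1) → ℝ) (Fin (m + 1) → ℝ)}

/-- The relevant component of `[Y_j, W]` is `Y_j(W_i) - W(Y_{j,i})`. In the first part the unit
added at `j` gives the new leading term, and units added after `j` give strictly smaller indices.
The second part is `μ W_i`, which involves only `γ` and smaller indices. -/
theorem HasLeadingTerm.lieBracket {p : (Fin (m + 1) → ℝ) → ℝ} (hp : SmoothNear p)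
    (hT : IsCoordChange T) {i : Fin m}
    {Y : Fin (m + 1) → (Fin (m + 1) → ℝ) → (Fin (m + 1) → ℝ)} (hY : IsChartTuple T i Y)
    {γ : Fin (m + 1) → ℕ} {W : (Fin (m + 1) → ℝ) → Fin (m + 1) → ℝ}
    (h : HasLeadingTerm T p i γ W) {j : Fin (m + 1)} (hj : j ≤ i.succ) :
    HasLeadingTerm T p i (γ + Pi.single j 1) (VectorField.lieBracket ℝ (Y j) W) := by
  have hTs := hT.smoothNear
  have hYj := hY.smooth j hj
  refine ⟨hYj.lieBracket h.smooth, fun c hc => ?_, by simp [h.proper], ?_⟩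
  · filter_upwards [coordComp_lieBracket hTs hYj h.smooth c,
      hY.der_eq_zero j hj W h.eq_zero c hc,
      der_eq_zero_of_eventuallyEq_const (V := Y j) (h.eq_zero c hc)] with x h1 h2 h3
    rw [h1, h2, h3, sub_zero]
  · obtain ⟨a, R, ha, ha0, hR, e⟩ := h.leading
    obtain ⟨μ, hμ, hμW⟩ := hY.der_eq_mul j hj
    have hpT := (hp.multiDeriv γ).comp hTs hT.map_zero
    -- The new remainder has four sources: units added at `k > j`; the derivative of the old
    -- remainder; the old leading derivative, with coefficient `Y_j(a) - μ a`; and `-μ R`.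
    have l1 : LowerOrder T p (PrecedesAt i.succ (γ + Pi.single j 1)) fun x =>
        a x * ∑ k ∈ Finset.univ.erase j,
          coordComp T (Y j) k x * multiDeriv (γ + Pi.single k 1) p (T x) :=
      (LowerOrder.sum _ fun k hk => LowerOrder.coordComp_term hTs hYj (hY.eq_zero j hj)
        fun hjk => precedesAt_add_single_add_single h.proper
          (lt_of_le_of_ne hjk (Finset.ne_of_mem_erase hk).symm)).mul_left ha
    have l2 := hR.der hTs hT.map_zero hp hYj (hY.eq_zero j hj)
      (Q' := PrecedesAt i.succ (γ + Pi.single j 1)) fun β hβ =>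
        ⟨hβ.add_single_left j, fun k hk => hβ.add_single hk⟩
    have l3 : LowerOrder T p (PrecedesAt i.succ (γ + Pi.single j 1)) fun x =>
        (der (Y j) a x - μ x * a x) * multiDeriv γ p (T x) :=
      .term ((hYj.der ha).sub (hμ.mul ha)) (precedesAt_add_single h.proper j)
    have l4 : LowerOrder T p (PrecedesAt i.succ (γ + Pi.single j 1)) fun x => (-1 * μ x) * R x :=
      (hR.mono fun β hβ => hβ.add_single_left j).mul_left (hμ.const_mul (-1))
    refine ⟨fun x => a x * coordComp T (Y j) j x, _, ha.mul (hTs.coordCompField hYj j),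
      mul_ne_zero ha0 (hY.ne_zero j hj), (l1.add l2).add (l3.add l4), ?_⟩
    filter_upwards [coordComp_lieBracket hTs hYj h.smooth i.castSucc, hμW W h.eq_zero, e,
      der_congr (V := Y j) e, der_add (V := Y j) (ha.mul hpT) (hR.smoothNear hTs hT.map_zero hp),
      der_mul (V := Y j) ha hpT, der_multiDeriv_comp hTs hT.map_zero hp (Y j) γ]
      with x h1 h2 h3 h4 h5 h6 h7
    rw [h1, h2, h3, h4, h5, h6, h7, ← Finset.add_sum_erase _ _ (Finset.mem_univ j)]
    ring

/-- The drift itself need not have vanishing early components, so the induction starts after one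
bracket. A bracket with `Y i.succ` kills the components before `i` and leaves a multiple of
`∂f_i/∂x_{i+1}` in component `i`. -/
theorem IsTriangularChart.hasLeadingTerm_single (hT : IsTriangularChart F G f T) {i : Fin m}
    {Y : Fin (m + 1) → (Fin (m + 1) → ℝ) → (Fin (m + 1) → ℝ)} (hY : IsChartTuple T i Y) :
    HasLeadingTerm T (fun x => f x i.castSucc) i (Pi.single i.succ 1)
      (VectorField.lieBracket ℝ (Y i.succ) F) := by
  have hYi := hY.smooth _ le_rfl
  have h0 : ∀ c : Fin (m + 1), (c : ℕ) < (i : ℕ) + 1 →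
      ∀ᶠ x in 𝓝 0, coordComp T (Y i.succ) c x = 0 := fun c hc =>
    hY.eq_zero _ le_rfl c (Fin.lt_def.2 (by simpa using hc))
  refine ⟨hYi.lieBracket hT.smooth_F,
    hT.coordComp_lieBracket_drift_eq_zero hYi h0, by simp,
    coordComp T (Y i.succ) i.succ, fun _ => 0,
    hT.toIsCoordChange.smoothNear.coordCompField hYi _, hY.ne_zero _ le_rfl, .zero, ?_⟩
  have h2 := hT.tendsto.eventually
    (multiDeriv_add_single 0 i.succ (hT.smooth_f.apply i.castSucc))
  filter_upwards [hT.coordComp_lieBracket_drift hYi h0, h2] with x h3 h4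
  rw [zero_add, multiDeriv_zero] at h4
  rw [h3, h4, add_zero]

/-- The alternative `γ = 0`, `W = F` is the state before any bracket is taken; `hj'` forces the
first bracket to be with `Y i.succ`. -/
theorem IsTriangularChart.hasLeadingTerm_iterate (hT : IsTriangularChart F G f T) {i : Fin m}
    {Y : Fin (m + 1) → (Fin (m + 1) → ℝ) → (Fin (m + 1) → ℝ)} (hY : IsChartTuple T i Y)
    {γ : Fin (m + 1) → ℕ} {W : (Fin (m + 1) → ℝ) → Fin (m + 1) → ℝ}
    (h : (γ = 0 ∧ W = F) ∨ HasLeadingTerm T (fun x => f x i.castSucc) i γ W) (j : Fin (m + 1))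
    (r : ℕ) (hj : r ≠ 0 → j ≤ i.succ) (hj' : r ≠ 0 → γ = 0 → j = i.succ) :
    (γ + Pi.single j r = 0 ∧ (VectorField.lieBracket ℝ (Y j))^[r] W = F) ∨
      HasLeadingTerm T (fun x => f x i.castSucc) i (γ + Pi.single j r)
        ((VectorField.lieBracket ℝ (Y j))^[r] W) := by
  induction r with
  | zero => simpa using h
  | succ r ih =>
    right
    have e : γ + Pi.single j (r + 1) = (γ + Pi.single j r) + Pi.single j 1 := by
      rw [add_assoc, ← Pi.single_add]
    rw [e, Function.iterate_succ_apply']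
    rcases ih (fun _ => hj (by simp)) (fun _ => hj' (by simp)) with ⟨h1, h2⟩ | h1
    · obtain rfl : j = i.succ := hj' (by simp) (funext fun k => by
        have := congrFun h1 k
        simp only [Pi.add_apply, Pi.zero_apply] at this ⊢
        omega)
      rw [h1, h2, zero_add]
      exact hT.hasLeadingTerm_single hY
    · exact h1.lieBracket (hT.smooth_f.apply _) hT.toIsCoordChange hY (hj (by simp))

theorem IsTriangularChart.hasLeadingTerm_adMulti (hT : IsTriangularChart F G f T) {i : Fin m}
    {Y : Fin (m + 1) → (Fin (m + 1) → ℝ) → (Fin (m + 1) → ℝ)} (hY : IsChartTuple T i Y)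
    {α : Fin (m + 1) → ℕ} (hα : IsProper ((i : ℕ) + 2) α) :
    HasLeadingTerm T (fun x => f x i.castSucc) i α (adMulti Y α F) := by
  have hαi : α i.succ ≠ 0 := by
    obtain ⟨j, hj, hj1⟩ := hα.2 (by simp)
    obtain rfl : j = i.succ := Fin.ext (by simpa using hj)
    omega
  -- The fold is evaluated from the right, so the induction runs over final segments of the
  -- coordinates, with `γ` the restriction of `α` to such a segment.
  have key : ∀ l : List (Fin (m + 1)), l.Nodup → l.Pairwise (· < ·) →
      (∀ a ∈ l, ∀ b, a < b → b ∈ l) →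
      let γ : Fin (m + 1) → ℕ := fun j => if j ∈ l then α j else 0
      let W := l.foldr (fun j W => (VectorField.lieBracket ℝ (Y j))^[α j] W) F
      (γ = 0 ∧ W = F) ∨ HasLeadingTerm T (fun x => f x i.castSucc) i γ W := by
    intro l
    induction l with
    | nil => exact fun _ _ _ => Or.inl ⟨funext fun j => by simp, rfl⟩
    | cons j l ih =>
      intro hnd hl hup
      rw [List.nodup_cons] at hnd
      rw [List.pairwise_cons] at hl
      have hup' : ∀ a ∈ l, ∀ b, a < b → b ∈ l := fun a ha b hab => by
        rcases List.mem_cons.1 (hup a (by simp [ha]) b hab) with rfl | h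
        · exact absurd (hl.1 a ha) hab.not_gt
        · exact h
      have hj : α j ≠ 0 → j ≤ i.succ := fun h => by
        by_contra hlt
        exact h (hα.1 j (by have := Fin.lt_def.1 (not_le.1 hlt); simp at this; omega))
      have := hT.hasLeadingTerm_iterate hY (ih hnd.2 hl.2 hup') j (α j) hj fun h h0 => by
        by_contra hne
        -- If `j` comes strictly before `i.succ`, brackets with `Y i.succ` are already inside,
        -- contradicting `γ = 0`.
        have hmem : i.succ ∈ l := by
          have := hup j (by simp) i.succ (lt_of_le_of_ne (hj h) hne)
          simpa [Ne.symm hne] using this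
        have h1 := congrFun h0 i.succ
        simp only [hmem, if_true, Pi.zero_apply] at h1
        exact hαi h1
      have e : (fun k => if k ∈ l then α k else 0) + Pi.single j (α j) =
          fun k => if k ∈ j :: l then α k else 0 := by
        funext k
        rcases eq_or_ne k j with rfl | hkj
        · simp [hnd.1]
        · simp [hkj]
      rw [e] at this
      exact this
  have h := key (List.finRange (m + 1)) (List.nodup_finRange _) (List.pairwise_lt_finRange _)
    fun _ _ b _ => List.mem_finRange b
  simp only [List.mem_finRange, if_true] at h
  rcases h with ⟨h, -⟩ | h
  · exact absurd (congrFun h i.succ) hαi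
  · exact h

/-- For `l ≥ i` the components before `i` of `X l` are zero, so those of `[X l, Y j]` are the
derivatives of the components of `Y j` along `X l`; adaptedness makes them vanish. For `l > i` this
holds for component `i` too. Since the `X l` with `l ≥ i` span the distribution pointwise, these
identities extend to every `W` in it. -/
theorem IsTriangularChart.isChartTuple (hT : IsTriangularChart F G f T)
    {D : ℕ → (Fin (m + 1) → ℝ) → Submodule ℝ (Fin (m + 1) → ℝ)} (hD : IsTriangularFlag F G D)
    {X : Fin (m + 1) → (Fin (m + 1) → ℝ) → (Fin (m + 1) → ℝ)} (hX : IsAdaptedFrame D X) {i : Fin m}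
    {Y : Fin (m + 1) → (Fin (m + 1) → ℝ) → (Fin (m + 1) → ℝ)} (hY : IsAdaptedTuple D X i Y) :
    IsChartTuple T i Y := by
  have hTs := hT.toIsCoordChange.smoothNear
  have zero_of_section : ∀ {l : ℕ} {V : (Fin (m + 1) → ℝ) → Fin (m + 1) → ℝ}, l ≤ m + 1 →
      SectionOf (D l) V → ∀ c : Fin (m + 1), (c : ℕ) < l → ∀ᶠ x in 𝓝 0, coordComp T V c x = 0 :=
    fun hl h => (sectionOf_annih_iff hTs).1 (h.congr (hT.eq_annih hD hl))
  have ne_zero : ∀ {l : Fin (m + 1)} {V : (Fin (m + 1) → ℝ) → Fin (m + 1) → ℝ},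
      SectionOf (D l) V → V 0 ∉ D ((l : ℕ) + 1) 0 → coordComp T V l 0 ≠ 0 := by
    intro l V h h0 hl
    rw [(hT.eq_annih hD (l := l + 1) l.isLt).self_of_nhds] at h0
    refine h0 fun c hc => ?_
    rw [← (coordComp_eq hTs).self_of_nhds]
    rcases Nat.lt_succ_iff_lt_or_eq.1 hc with h' | h'
    · exact (zero_of_section l.isLt.le h c h').self_of_nhds
    · rwa [Fin.ext h']
  have hXne : ∀ᶠ x in 𝓝 0, ∀ l, coordComp T (X l) l x ≠ 0 := eventually_all.2 fun l =>
    (hTs.coordCompField (hX l).1 l).self_of_nhds.continuousAt.eventually_ne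
      (ne_zero (hX l).2.1 (hX l).2.2)
  have hXz : ∀ᶠ x in 𝓝 0, ∀ l c : Fin (m + 1), c < l → coordComp T (X l) c x = 0 :=
    eventually_all.2 fun l => eventually_all.2 fun c => by
      by_cases hc : c < l
      · filter_upwards [zero_of_section l.isLt.le (hX l).2.1 c hc] with x hx _ using hx
      · exact Eventually.of_forall fun x h => absurd h hc
  have hspan : ∀ᶠ x in 𝓝 0, ∀ φ : (Fin (m + 1) → ℝ) →ₗ[ℝ] ℝ,
      (∀ l : Fin (m + 1), (i : ℕ) ≤ l → φ (X l x) = 0) →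
      ∀ v ∈ annih T i x, φ v = 0 := by
    filter_upwards [hXne, hXz, hT.fderiv_symm_fderiv, coordComp_eq hTs] with x h1 h2 h3 h4 φ hφ v hv
    refine eq_zero_of_triangular (fderiv ℝ T x).toLinearMap (fun v w h => ?_) (fun l => X l x)
      (fun l c hc => ?_) (fun l => ?_) φ i hφ v hv
    · rw [← h3 v, ← h3 w]
      exact congrArg _ h
    · exact (h4 (X l) c).symm.trans (h2 l c hc)
    · exact fun h => h1 l ((h4 (X l) l).trans h)
  have hXY : ∀ j ≤ i.succ, ∀ (l c : Fin (m + 1)), (i : ℕ) + 1 ≤ l → (c : ℕ) < (i : ℕ) + 1 →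
      ∀ᶠ x in 𝓝 0, der (X l) (coordComp T (Y j) c) x = 0 := by
    intro j hj l c hl hc
    obtain ⟨hYs, -, -, hbr, -⟩ := hY j hj
    filter_upwards [zero_of_section (by omega) (hbr l (Fin.le_def.2 (by simpa using hl))) c hc,
      coordComp_lieBracket hTs (hX l).1 hYs c,
      der_eq_zero_of_eventuallyEq_const (V := Y j)
        (zero_of_section l.isLt.le (hX l).2.1 c (by omega))] with x h1 h2 h3
    rw [h1, h3, sub_zero] at h2
    exact h2.symm
  refine ⟨fun j hj => (hY j hj).1, fun j hj c hc => zero_of_section j.isLt.le (hY j hj).2.1 c hc,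
    fun j hj => ne_zero (hY j hj).2.1 (hY j hj).2.2.1, fun j hj W hW c hc => ?_, fun j hj => ?_⟩
  · obtain ⟨hYs, -, -, -, hbr⟩ := hY j hj
    have h1 : ∀ᶠ x in 𝓝 0, ∀ l : Fin (m + 1), (i : ℕ) ≤ l →
        der (X l) (coordComp T (Y j) c) x = 0 := by
      refine eventually_all.2 fun l => ?_
      rcases lt_trichotomy (l : ℕ) i with h | h | h
      · exact Eventually.of_forall fun x h' => absurd h' (not_le.2 h)
      · obtain rfl : l = i.castSucc := Fin.ext h
        filter_upwards [zero_of_section (by omega) hbr c hc,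
          coordComp_lieBracket hTs (hX i.castSucc).1 hYs c,
          der_eq_zero_of_eventuallyEq_const (V := Y j)
            (zero_of_section i.castSucc.isLt.le (hX i.castSucc).2.1 c hc)] with x h1 h2 h3 _
        rw [h1, h3, sub_zero] at h2
        exact h2.symm
      · filter_upwards [hXY j hj l c h (by omega)] with x hx _ using hx
    filter_upwards [h1, hspan, (sectionOf_annih_iff hTs).2 hW] with x h2 h3 h4
    exact h3 (fderiv ℝ (coordComp T (Y j) c) x).toLinearMap h2 (W x) h4
  · obtain ⟨hYs, -, -, -, -⟩ := hY j hj
    have hXi := hX i.castSucc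
    -- This quotient makes the two functionals, differentiation of the `i`-th component and `μ`
    -- times the `i`-th component, agree on `X i.castSucc`; both vanish on the later `X l`.
    refine ⟨fun x => der (X i.castSucc) (coordComp T (Y j) i.castSucc) x /
      coordComp T (X i.castSucc) i.castSucc x,
      (hXi.1.der (hTs.coordCompField hYs _)).div (hTs.coordCompField hXi.1 _)
        (ne_zero hXi.2.1 hXi.2.2), fun W hW => ?_⟩
    have h1 : ∀ᶠ x in 𝓝 0, ∀ l : Fin (m + 1), (i : ℕ) + 1 ≤ l →
        der (X l) (coordComp T (Y j) i.castSucc) x = 0 := by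
      refine eventually_all.2 fun l => ?_
      by_cases h : (i : ℕ) + 1 ≤ l
      · filter_upwards [hXY j hj l i.castSucc h (by simp)] with x hx _ using hx
      · exact Eventually.of_forall fun x h' => absurd h' h
    filter_upwards [h1, hspan, (sectionOf_annih_iff hTs).2 hW, hXne, hXz, coordComp_eq hTs]
      with x h2 h3 h4 h5 h6 h7
    set μ := der (X i.castSucc) (coordComp T (Y j) i.castSucc) x /
      coordComp T (X i.castSucc) i.castSucc x with hμ
    have h8 := h3 ((fderiv ℝ (coordComp T (Y j) i.castSucc) x).toLinearMap -
      μ • (LinearMap.proj i.castSucc ∘ₗ (fderiv ℝ T x).toLinearMap)) (fun l hl => ?_) (W x) h4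
    · have h9 : der W (coordComp T (Y j) i.castSucc) x - μ * coordComp T W i.castSucc x = 0 := by
        rw [h7]
        exact h8
      linarith
    · have h9 : der (X l) (coordComp T (Y j) i.castSucc) x -
          μ * coordComp T (X l) i.castSucc x = 0 := by
        rcases hl.eq_or_lt with h | h
        · obtain rfl : l = i.castSucc := Fin.ext h.symm
          rw [hμ, div_mul_cancel₀ _ (h5 _), sub_self]
        · rw [h2 l h, h6 l _ (Fin.lt_def.2 h), mul_zero, sub_zero]
      rw [h7] at h9
      exact h9

/-- At the origin the remainder vanishes by `hlow`, and the leading coefficient is nonzero, so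
component `i` decides membership. -/
theorem IsTriangularChart.adMulti_mem_iff (hT : IsTriangularChart F G f T)
    {D : ℕ → (Fin (m + 1) → ℝ) → Submodule ℝ (Fin (m + 1) → ℝ)} (hD : IsTriangularFlag F G D)
    {X : Fin (m + 1) → (Fin (m + 1) → ℝ) → (Fin (m + 1) → ℝ)} (hX : IsAdaptedFrame D X) {i : Fin m}
    {Y : Fin (m + 1) → (Fin (m + 1) → ℝ) → (Fin (m + 1) → ℝ)} (hY : IsAdaptedTuple D X i Y)
    {α : Fin (m + 1) → ℕ} (hα : IsProper ((i : ℕ) + 2) α)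
    (hlow : ∀ β, SumLE β α → β ≠ α → β i.succ ≠ 0 → β ∉ indices fun x => f x i.castSucc) :
    adMulti Y α F 0 ∈ D ((i : ℕ) + 1) 0 ↔ α ∉ indices fun x => f x i.castSucc := by
  have hTs := hT.toIsCoordChange.smoothNear
  have h := hT.hasLeadingTerm_adMulti (hT.isChartTuple hD hX hY) hα
  obtain ⟨a, R, -, ha0, hR, e⟩ := h.leading
  have e0 := e.self_of_nhds
  beta_reduce at e0
  rw [hR.apply_zero hT.map_zero fun β hβ => not_not.1 (hlow β hβ.1 hβ.2.1 hβ.2.2), hT.map_zero,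
    add_zero] at e0
  rw [(hT.eq_annih hD (l := i + 1) (by omega)).self_of_nhds, mem_annih]
  have h1 : (∀ c : Fin (m + 1), (c : ℕ) < (i : ℕ) + 1 →
      fderiv ℝ T 0 (adMulti Y α F 0) c = 0) ↔ coordComp T (adMulti Y α F) i.castSucc 0 = 0 := by
    simp only [← (coordComp_eq hTs).self_of_nhds]
    refine ⟨fun h => h _ (by simp), fun h0 c hc => ?_⟩
    rcases Nat.lt_succ_iff_lt_or_eq.1 hc with h' | h'
    · exact (h.eq_zero c h').self_of_nhds
    · rwa [show c = i.castSucc from Fin.ext h']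
  rw [h1, e0, mul_eq_zero, or_iff_right ha0]
  simp [indices]

/-! ### Essential multi-indices as minimal elements -/

theorem eq_zero_of_mem_indices {n k : ℕ} {p : (Fin n → ℝ) → ℝ} (hp : SmoothNear p)
    (h : DependsOnFirst k p) {α : Fin n → ℕ} (hα : α ∈ indices p) (j : Fin n) (hj : k ≤ (j : ℕ)) :
    α j = 0 := by
  by_contra h0
  exact hα (multiDeriv_eq_zero_of_partialDeriv hp (h.partialDeriv_eq_zero hp j hj) h0).self_of_nhds

/-- The order is well founded, so a minimal proper index of `p` exists below `β`. Any index of `p`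
generating it is itself proper, hence cannot be different. -/
theorem exists_mem_essentialSet {n k : ℕ} {p : (Fin n → ℝ) → ℝ} (hp : SmoothNear p)
    (h : DependsOnFirst k p) {β : Fin n → ℕ} (hβ : β ∈ indices p) (hβk : IsProper k β) :
    ∃ ε ∈ essentialSet k p, SumLE ε β := by
  -- The sum of all initial sums is strictly monotone for `SumLE`.
  let size : (Fin n → ℕ) → ℕ := fun γ => ∑ J, ∑ j ∈ Finset.Iic J, γ j
  obtain ⟨ε, ⟨h1, h2, h3⟩, hmin⟩ := WellFounded.has_min (measure size).wf
    {γ | IsProper k γ ∧ γ ∈ indices p ∧ SumLE γ β} ⟨β, hβk, hβ, SumLE.refl β⟩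
  refine ⟨ε, ⟨h1, h2, fun α hα ⟨hg, hne⟩ => ?_⟩, h3⟩
  have hle := hg.sumLE
  refine hmin α ⟨hg.isProper h1 (eq_zero_of_mem_indices hp h hα), hα, hle.trans h3⟩ ?_
  change size α < size ε
  refine lt_of_le_of_ne (Finset.sum_le_sum fun J _ => hle J) fun heq => hne ?_
  refine hle.antisymm fun J => ?_
  exact ((Finset.sum_eq_sum_iff_of_le fun J _ => hle J).1 heq J (Finset.mem_univ J)).ge

theorem isProper_of_mem_indices {i : Fin m} {p : (Fin (m + 1) → ℝ) → ℝ} (hp : SmoothNear p)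
    (h : DependsOnFirst ((i : ℕ) + 2) p) {β : Fin (m + 1) → ℕ} (hβ : β ∈ indices p)
    (hβi : β i.succ ≠ 0) : IsProper ((i : ℕ) + 2) β :=
  ⟨eq_zero_of_mem_indices hp h hβ, fun _ => ⟨i.succ, by simp, Nat.one_le_iff_ne_zero.2 hβi⟩⟩

/-- A strictly smaller index of the component with nonzero entry at `i.succ` would be proper and
would generate `ε`, against its minimality; so no lower terms survive at `0`. -/
theorem IsTriangularChart.adMulti_notMem_of_mem_essentialType (hT : IsTriangularChart F G f T)
    {D : ℕ → (Fin (m + 1) → ℝ) → Submodule ℝ (Fin (m + 1) → ℝ)} (hD : IsTriangularFlag F G D)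
    {X : Fin (m + 1) → (Fin (m + 1) → ℝ) → (Fin (m + 1) → ℝ)} (hX : IsAdaptedFrame D X) {i : Fin m}
    {Y : Fin (m + 1) → (Fin (m + 1) → ℝ) → (Fin (m + 1) → ℝ)} (hY : IsAdaptedTuple D X i Y)
    {ε : Fin (m + 1) → ℕ} (hε : ε ∈ essentialType f i) :
    adMulti Y ε F 0 ∉ D ((i : ℕ) + 1) 0 := by
  obtain ⟨h1, h2, h3⟩ := hε
  rw [hT.adMulti_mem_iff hD hX hY h1 fun β hle hne hβi hβ => ?_]
  · exact not_not.2 h2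
  · exact h3 β hβ ⟨((isProper_of_mem_indices (hT.smooth_f.apply _) (hT.triangular i) hβ
      hβi).generates_iff h1.1).2 hle, hne⟩

/-- A proper multi-index whose iterated bracket is nontrivial is preceded by an essential one. -/
theorem IsTriangularChart.exists_sumLE_of_adMulti_notMem (hT : IsTriangularChart F G f T)
    {D : ℕ → (Fin (m + 1) → ℝ) → Submodule ℝ (Fin (m + 1) → ℝ)} (hD : IsTriangularFlag F G D)
    {X : Fin (m + 1) → (Fin (m + 1) → ℝ) → (Fin (m + 1) → ℝ)} (hX : IsAdaptedFrame D X) {i : Fin m}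
    {Y : Fin (m + 1) → (Fin (m + 1) → ℝ) → (Fin (m + 1) → ℝ)} (hY : IsAdaptedTuple D X i Y)
    {ζ : Fin (m + 1) → ℕ} (hζ : IsProper ((i : ℕ) + 2) ζ)
    (h : adMulti Y ζ F 0 ∉ D ((i : ℕ) + 1) 0) : ∃ ε ∈ essentialType f i, SumLE ε ζ := by
  by_contra! hno
  have hlow : ∀ β, SumLE β ζ → β i.succ ≠ 0 → β ∉ indices fun x => f x i.castSucc := by
    intro β hle hβi hβ
    obtain ⟨ε, hε, hle'⟩ := exists_mem_essentialSet (hT.smooth_f.apply _) (hT.triangular i) hβ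
      (isProper_of_mem_indices (hT.smooth_f.apply _) (hT.triangular i) hβ hβi)
    exact hno ε hε (hle'.trans hle)
  have hζi : ζ i.succ ≠ 0 := by
    obtain ⟨j, hj, hj1⟩ := hζ.2 (by simp)
    obtain rfl : j = i.succ := Fin.ext (by simpa using hj)
    omega
  exact h ((hT.adMulti_mem_iff hD hX hY hζ fun β hle _ hβi => hlow β hle hβi).2
    (hlow ζ (SumLE.refl ζ) hζi))

theorem IsTriangularChart.bracketTest (hT : IsTriangularChart F G f T)
    {D : ℕ → (Fin (m + 1) → ℝ) → Submodule ℝ (Fin (m + 1) → ℝ)} (hD : IsTriangularFlag F G D)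
    {X : Fin (m + 1) → (Fin (m + 1) → ℝ) → (Fin (m + 1) → ℝ)} (hX : IsAdaptedFrame D X) {i : Fin m}
    {Y : Fin (m + 1) → (Fin (m + 1) → ℝ) → (Fin (m + 1) → ℝ)} (hY : IsAdaptedTuple D X i Y) :
    BracketTest F D i Y (essentialType f i) := by
  refine ⟨fun ε hε => hT.adMulti_notMem_of_mem_essentialType hD hX hY hε, fun ζ hζ hno => ?_⟩
  by_contra h
  obtain ⟨ε, hε, hle⟩ := hT.exists_sumLE_of_adMulti_notMem hD hX hY hζ h
  exact hno ⟨ε, hε, (hε.1.generates_iff hζ.1).2 hle⟩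

/-- Both essential sets are antichains. The second half of the test puts an element of the set of
`h` below each element of that of `f`, and the first half does the converse, so the sets coincide.
-/
theorem IsTriangularChart.essentialType_eq_of_bracketTest (hT : IsTriangularChart F G f T)
    {D : ℕ → (Fin (m + 1) → ℝ) → Submodule ℝ (Fin (m + 1) → ℝ)} (hD : IsTriangularFlag F G D)
    {X : Fin (m + 1) → (Fin (m + 1) → ℝ) → (Fin (m + 1) → ℝ)} (hX : IsAdaptedFrame D X) {i : Fin m}
    {Y : Fin (m + 1) → (Fin (m + 1) → ℝ) → (Fin (m + 1) → ℝ)} (hY : IsAdaptedTuple D X i Y)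
    {h : (Fin (m + 1) → ℝ) → (Fin (m + 1) → ℝ)} (ht : BracketTest F D i Y (essentialType h i)) :
    essentialType f i = essentialType h i := by
  have below : ∀ ε' ∈ essentialType f i, ∃ ε ∈ essentialType h i, Generates ε ε' := by
    intro ε' hε'
    by_contra hno
    exact hT.adMulti_notMem_of_mem_essentialType hD hX hY hε' (ht.2 ε' hε'.1 hno)
  have sub : essentialType h i ⊆ essentialType f i := by
    intro ε hε
    obtain ⟨ε', hε', hle⟩ := hT.exists_sumLE_of_adMulti_notMem hD hX hY hε.1 (ht.1 ε hε)
    obtain ⟨ε'', hε'', hg⟩ := below ε' hε'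
    have hle' := hg.sumLE
    -- In the chain `ε'' ≤ ε' ≤ ε` the ends belong to one antichain, so all three are equal.
    obtain rfl : ε'' = ε := by
      by_contra hne
      exact hε.2.2 ε'' hε''.2.1 ⟨(hε''.1.generates_iff hε.1.1).2 (hle'.trans hle), hne⟩
    rwa [hle'.antisymm hle]
  refine Set.Subset.antisymm (fun ε' hε' => ?_) sub
  obtain ⟨ε, hε, hg⟩ := below ε' hε'
  obtain rfl : ε = ε' := by
    by_contra hne
    exact hε'.2.2 ε (sub hε).2.1 ⟨hg, hne⟩
  exact hε

end Brackets

/-! ### Existence of adapted data -/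

section Existence

/-- All the nondegeneracy conditions must hold on one common dense open set; finitely many open
dense sets intersect in such a set. -/
theorem isOpen_and_dense_ne_zero {X ι : Type*} [TopologicalSpace X] {N : Set X} (hN : IsOpen N)
    {q : ι → X → ℝ} (hq : ∀ i, ContinuousOn (q i) N)
    (hne : ∀ i, ∀ V : Set X, IsOpen V → V.Nonempty → V ⊆ N → ∃ x ∈ V, q i x ≠ 0) (s : Finset ι) :
    IsOpen {x ∈ N | ∀ i ∈ s, q i x ≠ 0} ∧ N ⊆ closure {x ∈ N | ∀ i ∈ s, q i x ≠ 0} := by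
  classical
  induction s using Finset.induction_on with
  | empty => simpa [hN] using subset_closure
  | insert a s ha ih =>
    have e : {x ∈ N | ∀ i ∈ insert a s, q i x ≠ 0} =
        (N ∩ q a ⁻¹' {0}ᶜ) ∩ {x ∈ N | ∀ i ∈ s, q i x ≠ 0} := by
      ext x
      simp only [Finset.forall_mem_insert, Set.mem_ofPred_eq, Set.mem_inter_iff, Set.mem_preimage,
        Set.mem_compl_iff, Set.mem_singleton_iff]
      tauto
    have ho : IsOpen (N ∩ q a ⁻¹' {0}ᶜ) := (hq a).isOpen_inter_preimage hN isOpen_compl_singleton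
    rw [e]
    refine ⟨ho.inter ih.1, fun x hx => mem_closure_iff.2 fun o hoo hxo => ?_⟩
    obtain ⟨y, ⟨hyo, hyN⟩, hy⟩ := hne a (o ∩ N) (hoo.inter hN) ⟨x, hxo, hx⟩ Set.inter_subset_right
    obtain ⟨z, ⟨hzo, hz⟩, hzs⟩ := mem_closure_iff.1 (ih.2 hyN) (o ∩ (N ∩ q a ⁻¹' {0}ᶜ))
      (hoo.inter ho) ⟨hyo, hyN, hy⟩
    exact ⟨z, hzo, hz, hzs⟩

theorem IsCoordChange.sectionOf_coordField {n : ℕ}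
    {T : OpenPartialHomeomorph (Fin n → ℝ) (Fin n → ℝ)} (hT : IsCoordChange T) (k : Fin n) :
    SectionOf (annih T k) (coordField T k) := by
  filter_upwards [hT.fderiv_coordField] with x hx c hc
  rw [hx]
  exact Pi.single_eq_of_ne (Fin.ne_of_val_ne hc.ne) _

theorem IsCoordChange.coordField_zero_notMem {n : ℕ}
    {T : OpenPartialHomeomorph (Fin n → ℝ) (Fin n → ℝ)} (hT : IsCoordChange T) (k : Fin n) :
    coordField T k 0 ∉ annih T ((k : ℕ) + 1) 0 := fun h => by
  have h1 := h k (Nat.lt_succ_self _)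
  rw [hT.fderiv_coordField.self_of_nhds] at h1
  simp at h1

theorem IsCoordChange.sectionOf_lieBracket_coordField {n : ℕ}
    {T : OpenPartialHomeomorph (Fin n → ℝ) (Fin n → ℝ)} (hT : IsCoordChange T) (j k : Fin n)
    (l : ℕ) :
    SectionOf (annih T l) (VectorField.lieBracket ℝ (coordField T j) (coordField T k)) :=
  (sectionOf_annih_iff hT.smoothNear).2 fun c _ => by
    filter_upwards [coordComp_lieBracket hT.smoothNear (hT.smoothNear_coordField j)
        (hT.smoothNear_coordField k) c,
      der_eq_zero_of_eventuallyEq_const (V := coordField T j) (hT.coordComp_coordField k c),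
      der_eq_zero_of_eventuallyEq_const (V := coordField T k) (hT.coordComp_coordField j c)]
      with x h1 h2 h3
    rw [h1, h2, h3, sub_zero]

/-- Subtracting the multiple of `w` that cancels component `i` of `v` moves `v` into the next
smaller distribution. -/
theorem annih_eq_span_sup {n : ℕ} {T : (Fin n → ℝ) → Fin n → ℝ} {i : Fin n} {x w : Fin n → ℝ}
    (hw : w ∈ annih T i x) (hwi : fderiv ℝ T x w i ≠ 0) :
    annih T i x = Submodule.span ℝ {w} ⊔ annih T ((i : ℕ) + 1) x := by
  refine le_antisymm (fun v hv => ?_) (sup_le ((Submodule.span_singleton_le_iff_mem _ _).2 hw)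
    (annih_anti T (Nat.le_succ _) x))
  set a := fderiv ℝ T x v i / fderiv ℝ T x w i with ha
  rw [← add_sub_cancel (a • w) v]
  refine Submodule.add_mem_sup (Submodule.smul_mem _ _ (Submodule.mem_span_singleton_self w))
    fun c hc => ?_
  rw [map_sub, map_smul, Pi.sub_apply, Pi.smul_apply, smul_eq_mul]
  rcases Nat.lt_succ_iff_lt_or_eq.1 hc with h | h
  · rw [hv c h, hw c h, mul_zero, sub_zero]
  · rw [Fin.ext h, ha, div_mul_cancel₀ _ hwi, sub_self]

variable {m : ℕ} {F G f : (Fin (m + 1) → ℝ) → (Fin (m + 1) → ℝ)}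
  {T : OpenPartialHomeomorph (Fin (m + 1) → ℝ) (Fin (m + 1) → ℝ)}

/-- With the coordinate field at `i.succ` as `H (i + 1)`, the bracket with `F` lies in `annih T i`
and its component `i` is `∂f_i/∂x_{i+1} ∘ T`. Where all these functions are nonzero the constructed
spans equal the `annih T i`, and nondegeneracy makes that set dense near `0`. -/
theorem IsTriangularChart.isTriangularFlag_annih (hT : IsTriangularChart F G f T)
    (hf : ∀ i : Fin m, ∃ U ∈ 𝓝 (0 : Fin (m + 1) → ℝ),
      ∀ V : Set (Fin (m + 1) → ℝ), IsOpen V → V.Nonempty → V ⊆ U →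
        ∃ x ∈ V, partialDeriv i.succ (fun y => f y i.castSucc) x ≠ 0) :
    IsTriangularFlag F G fun l => annih T l := by
  have hTs := hT.toIsCoordChange.smoothNear
  let H : ℕ → (Fin (m + 1) → ℝ) → Fin (m + 1) → ℝ := fun k =>
    if h : k < m + 1 then coordField T ⟨k, h⟩ else 0
  have hH : ∀ i : Fin m, H ((i : ℕ) + 1) = coordField T i.succ := fun i => by
    simp only [H, dif_pos (show (i : ℕ) + 1 < m + 1 by omega)]
    rfl
  have hE0 : ∀ i : Fin m, ∀ c : Fin (m + 1), (c : ℕ) < (i : ℕ) + 1 →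
      ∀ᶠ x in 𝓝 0, coordComp T (coordField T i.succ) c x = 0 :=
    fun i => (sectionOf_annih_iff hTs).1 (hT.toIsCoordChange.sectionOf_coordField i.succ)
  let q : Fin m → (Fin (m + 1) → ℝ) → ℝ := fun i x =>
    partialDeriv i.succ (fun y => f y i.castSucc) (T x)
  have hqs : ∀ i, SmoothNear (q i) := fun i =>
    ((hT.smooth_f.apply i.castSucc).partialDeriv i.succ).comp hTs hT.map_zero
  choose U hU hUne using hf
  have hgood : ∀ᶠ x in 𝓝 (0 : Fin (m + 1) → ℝ), annih T m x = Submodule.span ℝ {G x} ∧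
      x ∈ T.source ∧ ∀ i : Fin m, T x ∈ U i ∧ ContinuousAt (q i) x ∧
        VectorField.lieBracket ℝ (coordField T i.succ) F x ∈ annih T i x ∧
        fderiv ℝ T x (VectorField.lieBracket ℝ (coordField T i.succ) F x) i.castSucc = q i x := by
    have hsource : ∀ᶠ x in 𝓝 (0 : Fin (m + 1) → ℝ), x ∈ T.source :=
      T.open_source.mem_nhds hT.zero_mem
    refine hT.annih_last.and (hsource.and (eventually_all.2 fun i => ?_))
    filter_upwards [hT.tendsto.eventually (hU i), hqs i,
      (sectionOf_annih_iff hTs).2 (hT.coordComp_lieBracket_drift_eq_zero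
        (hT.toIsCoordChange.smoothNear_coordField i.succ) (hE0 i)),
      hT.coordComp_lieBracket_drift (hT.toIsCoordChange.smoothNear_coordField i.succ) (hE0 i),
      hT.toIsCoordChange.coordComp_coordField i.succ i.succ, coordComp_eq hTs]
      with x h1 h2 h3 h4 h5 h6
    refine ⟨h1, h2.continuousAt, h3, ?_⟩
    rw [← h6, h4, h5, Pi.single_eq_same, one_mul]
  obtain ⟨N, hNsub, hNo, hN0⟩ := mem_nhds_iff.1 hgood
  have hdense := isOpen_and_dense_ne_zero (q := q) hNo
    (fun i x hx => (hNsub hx).2.2 i |>.2.1.continuousWithinAt) (fun i V hV hVne hVN => by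
      -- Nondegeneracy is stated in the target coordinates, so it is applied to the open image `T ''
      -- V`.
      obtain ⟨_, ⟨x, hx, rfl⟩, hx0⟩ := hUne i (T '' V)
        (T.isOpen_image_of_subset_source hV fun x hx => (hNsub (hVN hx)).2.1) (hVne.image _)
        (by rintro _ ⟨x, hx, rfl⟩; exact ((hNsub (hVN hx)).2.2 i).1)
      exact ⟨x, hx, hx0⟩) Finset.univ
  refine ⟨hT.toIsCoordChange.annih_top, hT.annih_last,
    fun l _ => hT.toIsCoordChange.isInvolutiveDistribution_annih l, H,
    -- The recursion for `Dhat` in closed form: the span of the brackets with indices from `i` to `m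
    -- - 1`, joined with the span of `G`.
    fun i x => ((Finset.Ico i m).sup fun k =>
      Submodule.span ℝ {VectorField.lieBracket ℝ (H (k + 1)) F x}) ⊔ Submodule.span ℝ {G x},
    fun x => by simp, fun i hi => ?_⟩
  have hHi := hH ⟨i, hi⟩
  simp only at hHi
  refine ⟨hHi ▸ hT.toIsCoordChange.smoothNear_coordField _,
    hHi ▸ hT.toIsCoordChange.sectionOf_coordField (Fin.succ ⟨i, hi⟩),
    fun h => hT.toIsCoordChange.coordField_zero_notMem (Fin.succ ⟨i, hi⟩) (hHi ▸ h.self_of_nhds),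
    fun x => ?_,
    _, hdense.1, mem_of_superset (hNo.mem_nhds hN0) hdense.2, fun x hx => ?_⟩
  · rw [← sup_assoc, ← Finset.sup_insert (f := fun k =>
      Submodule.span ℝ {VectorField.lieBracket ℝ (H (k + 1)) F x}),
      Finset.insert_Ico_add_one_left_eq_Ico hi]
  · have hgx := hNsub hx.1
    have key : ∀ d k, k + d = m → annih T k x = ((Finset.Ico k m).sup fun k =>
        Submodule.span ℝ {VectorField.lieBracket ℝ (H (k + 1)) F x}) ⊔
          Submodule.span ℝ {G x} := by
      intro d
      induction d with
      | zero =>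
        rintro k rfl
        simpa using hgx.1
      | succ d ih =>
        intro k hk
        have hkm : k < m := by omega
        obtain ⟨-, -, h1, h2⟩ := hgx.2.2 ⟨k, hkm⟩
        rw [← Finset.insert_Ico_add_one_left_eq_Ico hkm, Finset.sup_insert, sup_assoc,
          ← ih (k + 1) (by omega), hH ⟨k, hkm⟩]
        refine annih_eq_span_sup (i := (⟨k, hkm⟩ : Fin m).castSucc) h1 ?_
        rw [h2]
        exact hx.2 _ (Finset.mem_univ _)
    exact key (m - i) i (by omega)

theorem IsCoordChange.isAdaptedFrame_coordField (hT : IsCoordChange T) :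
    IsAdaptedFrame (fun l => annih T l) (coordField T) := fun l =>
  ⟨hT.smoothNear_coordField l, hT.sectionOf_coordField l, hT.coordField_zero_notMem l⟩

theorem IsCoordChange.isAdaptedTuple_coordField (hT : IsCoordChange T) (i : Fin m) :
    IsAdaptedTuple (fun l => annih T l) (coordField T) i (coordField T) := fun j _ =>
  ⟨hT.smoothNear_coordField j, hT.sectionOf_coordField j, hT.coordField_zero_notMem j,
    fun l _ => hT.sectionOf_lieBracket_coordField l j _,
    hT.sectionOf_lieBracket_coordField _ j _⟩

end Existence

end TriForm

/-! ### The criterion -/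

theorem mainTheorem9 {m : ℕ}
    -- the system, of dimension `n = m + 1`
    (F G : (Fin (m + 1) → ℝ) → (Fin (m + 1) → ℝ))
    (hF : TriForm.SmoothNear F) (hG : TriForm.SmoothNear G) (hF0 : F 0 = 0) (hG0 : G 0 ≠ 0)
    -- a lower triangular form, which specifies the type
    (f g : (Fin (m + 1) → ℝ) → (Fin (m + 1) → ℝ)) (hfg : TriForm.IsLowerTriangularForm f g) :
    -- the criterion, with condition (ii) for every choice of the auxiliary data
    ((∃ f' g' : (Fin (m + 1) → ℝ) → (Fin (m + 1) → ℝ),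
        TriForm.IsLowerTriangularForm f' g' ∧
        TriForm.essentialType f' = TriForm.essentialType f ∧
        TriForm.FeedbackEquivalent F G f' g') ↔
      (∃ f' g' : (Fin (m + 1) → ℝ) → (Fin (m + 1) → ℝ),
        TriForm.IsLowerTriangularForm f' g' ∧ TriForm.FeedbackEquivalent F G f' g') ∧
      ∀ (D : ℕ → (Fin (m + 1) → ℝ) → Submodule ℝ (Fin (m + 1) → ℝ))
        (X : Fin (m + 1) → (Fin (m + 1) → ℝ) → (Fin (m + 1) → ℝ)),
        TriForm.IsTriangularFlag F G D → TriForm.IsAdaptedFrame D X →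
        ∀ (i : Fin m) (Y : Fin (m + 1) → (Fin (m + 1) → ℝ) → (Fin (m + 1) → ℝ)),
          TriForm.IsAdaptedTuple D X i Y →
          TriForm.BracketTest F D i Y (TriForm.essentialType f i)) ∧
    -- the same criterion, with condition (ii) for one choice of the auxiliary data
    ((∃ f' g' : (Fin (m + 1) → ℝ) → (Fin (m + 1) → ℝ),
        TriForm.IsLowerTriangularForm f' g' ∧
        TriForm.essentialType f' = TriForm.essentialType f ∧
        TriForm.FeedbackEquivalent F G f' g') ↔
      (∃ f' g' : (Fin (m + 1) → ℝ) → (Fin (m + 1) → ℝ),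
        TriForm.IsLowerTriangularForm f' g' ∧ TriForm.FeedbackEquivalent F G f' g') ∧
      ∃ (D : ℕ → (Fin (m + 1) → ℝ) → Submodule ℝ (Fin (m + 1) → ℝ))
        (X : Fin (m + 1) → (Fin (m + 1) → ℝ) → (Fin (m + 1) → ℝ)),
        TriForm.IsTriangularFlag F G D ∧ TriForm.IsAdaptedFrame D X ∧
        ∀ i : Fin m, ∃ Y : Fin (m + 1) → (Fin (m + 1) → ℝ) → (Fin (m + 1) → ℝ),
          TriForm.IsAdaptedTuple D X i Y ∧
          TriForm.BracketTest F D i Y (TriForm.essentialType f i)) := by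
  have type_eq : ∀ f' g' : (Fin (m + 1) → ℝ) → (Fin (m + 1) → ℝ),
      TriForm.IsLowerTriangularForm f' g' → TriForm.FeedbackEquivalent F G f' g' →
      (∃ (D : ℕ → (Fin (m + 1) → ℝ) → Submodule ℝ (Fin (m + 1) → ℝ))
        (X : Fin (m + 1) → (Fin (m + 1) → ℝ) → (Fin (m + 1) → ℝ)),
        TriForm.IsTriangularFlag F G D ∧ TriForm.IsAdaptedFrame D X ∧
        ∀ i : Fin m, ∃ Y : Fin (m + 1) → (Fin (m + 1) → ℝ) → (Fin (m + 1) → ℝ),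
          TriForm.IsAdaptedTuple D X i Y ∧
          TriForm.BracketTest F D i Y (TriForm.essentialType f i)) →
      TriForm.essentialType f' = TriForm.essentialType f := by
    rintro f' g' hfg' he ⟨D, X, hD, hX, hY⟩
    obtain ⟨T, hT⟩ := he.exists_isTriangularChart hF hfg'
    funext i
    obtain ⟨Y, hYi, ht⟩ := hY i
    exact hT.essentialType_eq_of_bracketTest hD hX hYi ht
  have test : ∀ f' g' : (Fin (m + 1) → ℝ) → (Fin (m + 1) → ℝ),
      TriForm.IsLowerTriangularForm f' g' → TriForm.essentialType f' = TriForm.essentialType f →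
      TriForm.FeedbackEquivalent F G f' g' →
      ∀ (D : ℕ → (Fin (m + 1) → ℝ) → Submodule ℝ (Fin (m + 1) → ℝ))
        (X : Fin (m + 1) → (Fin (m + 1) → ℝ) → (Fin (m + 1) → ℝ)),
        TriForm.IsTriangularFlag F G D → TriForm.IsAdaptedFrame D X →
        ∀ (i : Fin m) (Y : Fin (m + 1) → (Fin (m + 1) → ℝ) → (Fin (m + 1) → ℝ)),
          TriForm.IsAdaptedTuple D X i Y →
          TriForm.BracketTest F D i Y (TriForm.essentialType f i) := by
    intro f' g' hfg' ht he D X hD hX i Y hY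
    obtain ⟨T, hT⟩ := he.exists_isTriangularChart hF hfg'
    rw [← ht]
    exact hT.bracketTest hD hX hY
  -- Existence of admissible data keeps the universally quantified condition from being vacuous and
  -- provides the single choice in the second equivalence.
  have exists_data : ∀ f' g' : (Fin (m + 1) → ℝ) → (Fin (m + 1) → ℝ),
      TriForm.IsLowerTriangularForm f' g' → TriForm.FeedbackEquivalent F G f' g' →
      ∃ (D : ℕ → (Fin (m + 1) → ℝ) → Submodule ℝ (Fin (m + 1) → ℝ))
        (X : Fin (m + 1) → (Fin (m + 1) → ℝ) → (Fin (m + 1) → ℝ)),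
        TriForm.IsTriangularFlag F G D ∧ TriForm.IsAdaptedFrame D X ∧
        ∀ i : Fin m, ∃ Y : Fin (m + 1) → (Fin (m + 1) → ℝ) → (Fin (m + 1) → ℝ),
          TriForm.IsAdaptedTuple D X i Y := by
    intro f' g' hfg' he
    obtain ⟨T, hT⟩ := he.exists_isTriangularChart hF hfg'
    exact ⟨fun l => TriForm.annih T l, TriForm.coordField T,
      hT.isTriangularFlag_annih hfg'.nondegenerate, hT.toIsCoordChange.isAdaptedFrame_coordField,
      fun i => ⟨_, hT.toIsCoordChange.isAdaptedTuple_coordField i⟩⟩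
  refine ⟨⟨?_, ?_⟩, ⟨?_, ?_⟩⟩
  · rintro ⟨f', g', hfg', ht, he⟩
    exact ⟨⟨f', g', hfg', he⟩, test f' g' hfg' ht he⟩
  · rintro ⟨⟨f', g', hfg', he⟩, hall⟩
    obtain ⟨D, X, hD, hX, hY⟩ := exists_data f' g' hfg' he
    refine ⟨f', g', hfg', type_eq f' g' hfg' he ⟨D, X, hD, hX, fun i => ?_⟩, he⟩
    obtain ⟨Y, hYi⟩ := hY i
    exact ⟨Y, hYi, hall D X hD hX i Y hYi⟩
  · rintro ⟨f', g', hfg', ht, he⟩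
    obtain ⟨D, X, hD, hX, hY⟩ := exists_data f' g' hfg' he
    refine ⟨⟨f', g', hfg', he⟩, D, X, hD, hX, fun i => ?_⟩
    obtain ⟨Y, hYi⟩ := hY i
    exact ⟨Y, hYi, test f' g' hfg' ht he D X hD hX i Y hYi⟩
  · rintro ⟨⟨f', g', hfg', he⟩, hdata⟩
    exact ⟨f', g', hfg', type_eq f' g' hfg' he hdata, he⟩
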